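/- Let $T$ be a finite rooted directed binary tree (all edges point away from the root, every vertex that is not a leaf has exactly two children), let $O$ be its set of leaves, and let the leaves be labeled bijectively by $[n]=\{1,\dots,n\}$. Write $V$ and $E$ for the vertices and edges of $T$. For $i,j\in V$ a trek between $i$ and $j$ is a simple path $P$ from $i$ to $j$ in the underlying undirected tree that contains no two distinct edges $a\to k$, $b\to k$ with the same head; $\mathrm{top}(P)$ is the unique vertex of $P$ that is not the head of an edge of $P$ (for $i=j$ the only trek is the empty one, with top $i$). Let $$\phi_T:\mathbb{C}[\sigma_{ij}\mid i,j\in V,\ \sigma_{ij}=\sigma_{ji}]\to\mathbb{C}[a_v,\lambda_{kl}\mid v\in V,\ k\to l\in E],\qquad \sigma_{ij}\mapsto\sum_{P}a_{\mathrm{top}(P)}\prod_{k\to l\in P}\lambda_{kl},$$ where the sum is over the treks $P$ between $i$ and $j$, let $I_T=\ker\phi_T$, and let $I_{T,O}=I_T\cap\mathbb{C}[\sigma_{ij}\mid i,j\in O]$, regarded via the labeling as an ideal of $\mathbb{C}[\Sigma]=\mathbb{C}[\sigma_{ij}\mid 1\le i\le j\le n]$. Let $I_{2,n}\subset\mathbb{C}[\Sigma]$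 be the ideal of the Grassmannian $Gr_{2,n}$ in its Plücker embedding, that is, the ideal of all polynomials that vanish whenever the $\sigma_{ij}$, $i<j$, are the $2\times2$ minors of a $2\times n$ complex matrix (the diagonal coordinates $\sigma_{ii}$ being arbitrary). For $\omega\in\mathbb{R}^{\binom{n+1}{2}}$ let $\mathrm{in}_\omega(I)$ be the ideal generated by the initial forms (sums of the terms of maximal $\omega$-weight) of the elements of $I$; a sign vector $\tau\in\{\pm1\}^{\binom{n+1}{2}}$ acts by multiplying $\sigma_{ij}$ by $\tau_{ij}$. Then there are a weight vector $\omega\in\mathbb{R}^{\binom{n+1}{2}}$ and a sign vector $\tau\in\{\pm1\}^{\binom{n+1}{2}}$ such that $$I_{T,O}=\tau\cdot\mathrm{in}_\omega(I_{2,n}).$$ Moreover $I_{T,O}$ is a toric degeneration of $I_{2,n}$: it is a toric ideal (the kernel of a homomorphism from $\mathbb{C}[\Sigma]$ to a Laurent polynomial ring over $\mathbb{C}$ that sends each $\sigma_{ij}$ to a Laurent monomial), and there is an ideal $F\subset\mathbb{C}[t][\Sigma]$, homogeneous in the $\sigma_{ij}$, such that $\mathbb{C}[t][\Sigma]/F$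 is flat over $\mathbb{C}[t]$, the specialization of $F$ at $t=0$ is $I_{T,O}$, and for every $c\in\mathbb{C}\setminus\{0\}$ the specialization of $F$ at $t=c$ is obtained from $I_{2,n}$ by multiplying the coordinates $\sigma_{ij}$ by nonzero constants. -/

import Mathlib

noncomputable section

namespace HiddenTree

open MvPolynomial

section Trek

variable {V : Type*} (G : Digraph V)

/-- A trek between `i` and `j` in the directed acyclic graph `G`: a simple path `path` from `i` to
`j` in the underlying undirected graph that contains no collider (no two distinct edges `a → k`,
`b → k` with the same head), recorded together with its topmost vertex `top`, the (unique) vertex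
of the path that is not the head of any edge of the path. -/
@[ext]
structure Trek (i j : V) where
  path : G.toSimpleGraphInclusive.Walk i j
  isPath : path.IsPath
  noCollider : ∀ a b k : V, G.Adj a k → G.Adj b k →
    s(a, k) ∈ path.edges → s(b, k) ∈ path.edges → a = b
  top : V
  top_mem : top ∈ path.support
  top_isTop : ∀ k : V, G.Adj k top → s(k, top) ∉ path.edges

/-- The directed edges of `G`. -/
abbrev Edge : Type _ := {e : V × V // G.Adj e.1 e.2}

/-- The indeterminates of the parameter ring: `a_v` for the vertices (`Sum.inl v`) and `λ_e` for
the edges (`Sum.inr e`). -/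
abbrev Param : Type _ := V ⊕ Edge G

variable {G}

/-- Reversal of treks. -/
def Trek.reverse {i j : V} (P : Trek G i j) : Trek G j i where
  path := P.path.reverse
  isPath := P.isPath.reverse
  noCollider a b k ha hb h₁ h₂ := by
    rw [SimpleGraph.Walk.edges_reverse, List.mem_reverse] at h₁ h₂
    exact P.noCollider a b k ha hb h₁ h₂
  top := P.top
  top_mem := by
    rw [SimpleGraph.Walk.support_reverse, List.mem_reverse]
    exact P.top_mem
  top_isTop k hk h := by
    rw [SimpleGraph.Walk.edges_reverse, List.mem_reverse] at h
    exact P.top_isTop k hk h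

/-- Reversal is a bijection between the treks from `i` to `j` and those from `j` to `i`. -/
def Trek.reverseEquiv (i j : V) : Trek G i j ≃ Trek G j i where
  toFun := Trek.reverse
  invFun := Trek.reverse
  left_inv P := by ext1 <;> simp [Trek.reverse]
  right_inv P := by ext1 <;> simp [Trek.reverse]

/-- The monomial `a_{top(P)} ∏_{k → l ∈ P} λ_{kl}` of a trek `P`. -/
def Trek.monomial {i j : V} (P : Trek G i j) : MvPolynomial (Param G) ℂ :=
  X (Sum.inl P.top) *
    ∏ᶠ (e : Edge G) (_ : s(e.1.1, e.1.2) ∈ P.path.edges), X (Sum.inr e)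

theorem Trek.monomial_reverse {i j : V} (P : Trek G i j) :
    P.reverse.monomial = P.monomial := by
  simp [Trek.monomial, Trek.reverse]

variable (G)

/-- The sum of the monomials of all treks between `i` and `j` (a finite sum if `V` is finite). -/
def trekSum (i j : V) : MvPolynomial (Param G) ℂ := ∑ᶠ P : Trek G i j, P.monomial

theorem trekSum_comm (i j : V) : trekSum G i j = trekSum G j i :=
  finsum_eq_of_bijective _ (Trek.reverseEquiv i j).bijective
    fun P => (Trek.monomial_reverse P).symm

/-- The trek rule homomorphism `φ_G : ℂ[σ_{ij}] → ℂ[a_i, λ_{ij}]`. The covariance indeterminates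
`σ_{ij} = σ_{ji}` are indexed by the unordered pairs of (not necessarily distinct) vertices. -/
def trekHom : MvPolynomial (Sym2 V) ℂ →ₐ[ℂ] MvPolynomial (Param G) ℂ :=
  aeval (Sym2.lift ⟨trekSum G, trekSum_comm G⟩)

/-- The ideal `I_G` of the Gaussian Bayesian network of `G`. -/
def networkIdeal : Ideal (MvPolynomial (Sym2 V) ℂ) := RingHom.ker (trekHom G)

/-- The ideal `I_{G,O} = I_G ∩ ℂ[σ_{ij} | i, j ∈ O]` of the network with observed vertices given by
the (injective) family `obs`, as an ideal of `ℂ[σ_{ij} | i, j ∈ O]`. -/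
def observedIdeal {O : Type*} (obs : O → V) : Ideal (MvPolynomial (Sym2 O) ℂ) :=
  (networkIdeal G).comap (rename (Sym2.map obs) : MvPolynomial (Sym2 O) ℂ →ₐ[ℂ] _)

/-- A leaf: a vertex without children. -/
def IsLeaf (v : V) : Prop := ∀ w, ¬ G.Adj v w

/-- A rooted directed binary tree: all edges point away from a root, and every vertex that is not
a leaf has exactly two children. -/
structure IsRootedBinaryTree : Prop where
  exists_root : ∃ r : V, (∀ v, ¬ G.Adj v r) ∧ ∀ v, Relation.ReflTransGen G.Adj r v
  parent_unique : ∀ v a b : V, G.Adj a v → G.Adj b v → a = b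
  binary : ∀ v : V, ¬ IsLeaf G v → {w | G.Adj v w}.ncard = 2

end Trek

section Initial

variable {ι : Type*}

open Classical in
/-- The initial form of `f`: the sum of its terms of maximal `ω`-weight. -/
def initialForm (ω : ι → ℝ) (f : MvPolynomial ι ℂ) : MvPolynomial ι ℂ :=
  ∑ u ∈ f.support with ∀ v ∈ f.support, Finsupp.weight ω v ≤ Finsupp.weight ω u,
    monomial u (coeff u f)

/-- The initial ideal `in_ω(I)`. -/
def initialIdeal (ω : ι → ℝ) (I : Ideal (MvPolynomial ι ℂ)) : Ideal (MvPolynomial ι ℂ) :=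
  Ideal.span (initialForm ω '' I)

/-- The ideal obtained from `I` by multiplying each coordinate `x_i` by the unit `c_i`. -/
def rescale (c : ι → ℂˣ) (I : Ideal (MvPolynomial ι ℂ)) : Ideal (MvPolynomial ι ℂ) :=
  I.map (aeval fun i => C (c i : ℂ) * X i : MvPolynomial ι ℂ →ₐ[ℂ] MvPolynomial ι ℂ)

/-- The action of a sign vector on ideals. -/
def signAct (τ : ι → ℤˣ) (I : Ideal (MvPolynomial ι ℂ)) : Ideal (MvPolynomial ι ℂ) :=
  rescale (fun i => Units.map (Int.castRingHom ℂ : ℤ →* ℂ) (τ i)) I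

/-- A toric ideal: the kernel of a homomorphism to a Laurent polynomial ring
`ℂ[t₁^{±1}, …, t_m^{±1}]` that sends each indeterminate to a Laurent monomial. -/
def IsToricIdeal (J : Ideal (MvPolynomial ι ℂ)) : Prop :=
  ∃ (m : ℕ) (A : ι → Fin m → ℤ),
    J = RingHom.ker (aeval fun i => AddMonoidAlgebra.single (A i) 1 :
      MvPolynomial ι ℂ →ₐ[ℂ] AddMonoidAlgebra ℂ (Fin m → ℤ))

/-- The ideal of the fibre over the point `c` of the affine line of a family of closed subschemes
of affine space given by an ideal of `ℂ[t][x_i]`. -/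
def fiberIdeal (F : Ideal (MvPolynomial ι (Polynomial ℂ))) (c : ℂ) : Ideal (MvPolynomial ι ℂ) :=
  F.map (MvPolynomial.map (Polynomial.evalRingHom c))

/-- `J` is a toric degeneration of the homogeneous ideal `I`: `J` is toric, and there is a
homogeneous ideal of `ℂ[t][x_i]` defining a family, flat over the affine line, whose fibre over
`0` is defined by `J` and whose fibre over every `c ≠ 0` is defined by `I` up to a rescaling of the
coordinates. -/
def IsToricDegeneration (I J : Ideal (MvPolynomial ι ℂ)) : Prop :=
  IsToricIdeal J ∧
    ∃ F : Ideal (MvPolynomial ι (Polynomial ℂ)),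
      (∀ f ∈ F, ∀ d : ℕ, homogeneousComponent d f ∈ F) ∧
      Module.Flat (Polynomial ℂ) (MvPolynomial ι (Polynomial ℂ) ⧸ F) ∧
      (∀ c : ℂ, c ≠ 0 → ∃ u : ι → ℂˣ, fiberIdeal F c = rescale u I) ∧
      fiberIdeal F 0 = J

end Initial

/-- The affine cone over the Grassmannian `Gr_{2,n}` in its Plücker embedding: the coordinates
`σ_{ij}`, `i < j`, are the `2 × 2` minors of a `2 × n` matrix. The ambient space has in addition the
diagonal coordinates `σ_{ii}`, which are free. -/
def grassmannianCone (n : ℕ) : Set (Sym2 (Fin n) → ℂ) :=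
  {p | ∃ A : Matrix (Fin 2) (Fin n) ℂ, ∀ i j : Fin n, i < j →
    p s(i, j) = (A.submatrix id ![i, j]).det}

/-- The ideal `I_{2,n}` of the Grassmannian `Gr_{2,n}` in `ℂ[σ_{ij} | i ≤ j]`. -/
def grassmannianIdeal (n : ℕ) : Ideal (MvPolynomial (Sym2 (Fin n)) ℂ) :=
  vanishingIdeal ℂ (grassmannianCone n)

end HiddenTree

end

noncomputable section

namespace HiddenTree

open MvPolynomial

/-! ### Ancestry as a meet-semilattice with the root at the bottom. -/

section TreeOrder

variable {V : Type*} {T : Digraph V}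

open Relation

/-! In a rooted tree any two vertices are joined by exactly one trek, so `φ_T` sends each `σ_ij` to
a monomial (`trekSum_eq`) and `I_{T,O}` is a toric ideal, spanned by binomials. The exponent of the
image of a monomial determines its shape: the number of factors with each lowest common ancestor,
and the number of off-diagonal factors at each leaf. Two monomials of the same shape are connected
by moves `σ_ac σ_bd → σ_ad σ_bc`, where an edge of the tree separates `a, b` from `c, d`
(`IsPlanarTree.monomial_sub_mem`). Hence `I_{T,O}` lies in every ideal that contains these quadrics.

On the Grassmannian side, let `δ` increase strictly away from the root and give `σ_ij` the weight
`-δ(lca(i,j))`. In the three-term Plücker relation on `a, b, c, d` the terms `ac·bd` and `ad·bc`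
have equal weight, and `ab·cd` has smaller weight. Signs from a planar embedding of the tree turn
the initial form into the quadric above.

For the reverse inclusion, matrices with columns `(x_i, x_i y_i)` are used, where `y_i = ∑ b_v
t^δ(v)` over the `v` with `i` to the right. The lowest term of `y_j - y_i` in `t` is `± b_v t^δ(v)`
with `v = lca(i,j)`. Removing this sign and this power of `t` from the minors gives a family over
`ℂ[t]` whose parametrization is monomial at `t = 0`. If `F` is the kernel of the parametrization,
then `I_{T,O} ≤ τ·in_ω(I_{2,n}) ≤ F|_{t=0} ≤ (kernel of the monomial map at t = 0) ≤ I_{T,O}`. The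
outer inclusions come from the quadrics. The second holds because an initial form is the value at `t
= 0` of a rescaled element of `I_{2,n}`. The chain gives all equalities; flatness is
torsion-freeness over `ℂ[t]`, and the fibres at `c ≠ 0` are computed on points. -/

theorem IsRootedBinaryTree.not_transGen_self (hT : IsRootedBinaryTree T) (v : V) :
    ¬ TransGen T.Adj v v := by
  obtain ⟨r, hr, hreach⟩ := hT.exists_root
  induction hreach v with
  | refl =>
    intro h
    obtain ⟨c, -, hc⟩ := TransGen.tail'_iff.1 h
    exact hr _ hc
  | tail _ huv ih =>
    intro h
    obtain ⟨c, hvc, hc⟩ := TransGen.tail'_iff.1 h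
    obtain rfl := hT.parent_unique _ _ _ huv hc
    exact ih (TransGen.head'_iff.2 ⟨_, huv, hvc⟩)

/-- Induction along the path from the root to `i`: if `i` is not an ancestor of `j`, its common
ancestors with `j` are those of its parent. -/
theorem IsRootedBinaryTree.exists_lowest_common_ancestor (hT : IsRootedBinaryTree T) (i j : V) :
    ∃ m, ∀ x, ReflTransGen T.Adj x m ↔ ReflTransGen T.Adj x i ∧ ReflTransGen T.Adj x j := by
  obtain ⟨r, hr, hreach⟩ := hT.exists_root
  induction hreach i with
  | refl =>
    refine ⟨r, fun x => ⟨fun h => ⟨h, h.trans (hreach j)⟩, fun h => h.1⟩⟩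
  | @tail p i _ hpi ih =>
    by_cases hij : ReflTransGen T.Adj i j
    · exact ⟨i, fun x => ⟨fun h => ⟨h, h.trans hij⟩, fun h => h.1⟩⟩
    · obtain ⟨m, hm⟩ := ih
      refine ⟨m, fun x => ⟨fun h => ⟨((hm x).1 h).1.tail hpi, ((hm x).1 h).2⟩, ?_⟩⟩
      rintro ⟨hxi, hxj⟩
      rcases ReflTransGen.cases_tail hxi with rfl | ⟨c, hxc, hc⟩
      · exact absurd hxj hij
      · obtain rfl := hT.parent_unique _ _ _ hpi hc
        exact (hm x).2 ⟨hxc, hxj⟩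

/-- The vertices of a rooted tree, ordered by ancestry; infima are lowest common ancestors. -/
abbrev IsRootedBinaryTree.semilatticeInf (hT : IsRootedBinaryTree T) : SemilatticeInf V where
  le := ReflTransGen T.Adj
  le_refl _ := ReflTransGen.refl
  le_trans _ _ _ := ReflTransGen.trans
  le_antisymm a b hab hba := by
    rcases reflTransGen_iff_eq_or_transGen.1 hab with h | h
    · exact h.symm
    · exact absurd (h.trans_left hba) (hT.not_transGen_self a)
  inf i j := (hT.exists_lowest_common_ancestor i j).choose
  inf_le_left i j :=
    (((hT.exists_lowest_common_ancestor i j).choose_spec _).1 ReflTransGen.refl).1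
  inf_le_right i j :=
    (((hT.exists_lowest_common_ancestor i j).choose_spec _).1 ReflTransGen.refl).2
  le_inf a i j hi hj := ((hT.exists_lowest_common_ancestor i j).choose_spec a).2 ⟨hi, hj⟩

variable [SemilatticeInf V]

theorem IsRootedBinaryTree.le_total_of_le (hT : IsRootedBinaryTree T)
    (hle : ∀ a b : V, a ≤ b ↔ ReflTransGen T.Adj a b) {a b c : V} (hac : a ≤ c) (hbc : b ≤ c) :
    a ≤ b ∨ b ≤ a := by
  rw [hle, ← reflTransGen_swap] at hac hbc
  have hU : Relator.RightUnique (Function.swap T.Adj) := fun x y z hy hz =>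
    hT.parent_unique _ _ _ hy hz
  rcases ReflTransGen.total_of_right_unique hU hac hbc with h | h <;>
    rw [reflTransGen_swap, ← hle] at h
  exacts [Or.inr h, Or.inl h]

theorem IsRootedBinaryTree.lt_of_adj (hT : IsRootedBinaryTree T)
    (hle : ∀ a b : V, a ≤ b ↔ ReflTransGen T.Adj a b) {a b : V} (h : T.Adj a b) : a < b := by
  refine lt_of_le_of_ne ((hle _ _).2 (ReflTransGen.single h)) ?_
  rintro rfl
  exact hT.not_transGen_self a (TransGen.single h)

theorem IsRootedBinaryTree.le_parent (hT : IsRootedBinaryTree T)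
    (hle : ∀ a b : V, a ≤ b ↔ ReflTransGen T.Adj a b) {a p v : V} (hp : T.Adj p v) (h : a < v) :
    a ≤ p := by
  rcases ReflTransGen.cases_tail ((hle _ _).1 h.le) with rfl | ⟨c, hac, hc⟩
  · exact absurd h (lt_irrefl _)
  · obtain rfl := hT.parent_unique _ _ _ hp hc
    exact (hle _ _).2 hac

theorem exists_child_of_lt (hle : ∀ a b : V, a ≤ b ↔ ReflTransGen T.Adj a b) {a b : V}
    (h : a < b) : ∃ c, T.Adj a c ∧ c ≤ b := by
  rcases ReflTransGen.cases_head ((hle _ _).1 h.le) with rfl | ⟨c, hac, hc⟩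
  · exact absurd h (lt_irrefl _)
  · exact ⟨c, hac, (hle _ _).2 hc⟩

theorem exists_parent_of_not_le (hle : ∀ a b : V, a ≤ b ↔ ReflTransGen T.Adj a b)
    (hT : IsRootedBinaryTree T) {a b : V}
    (h : ¬ a ≤ b) : ∃ p, T.Adj p a := by
  obtain ⟨r, hr, hreach⟩ := hT.exists_root
  rcases ReflTransGen.cases_tail (hreach a) with rfl | ⟨c, -, hc⟩
  · exact absurd ((hle _ _).2 (hreach b)) h
  · exact ⟨c, hc⟩

end TreeOrder

/-! ### Treks in a rooted tree: existence, uniqueness and monomial. -/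

section TrekSum

variable {V : Type*} {T : Digraph V} [SemilatticeInf V]

open Relation SimpleGraph

open Classical in
/-- A walk crosses the edge into `l` an odd number of times if and only if it leaves or enters
the set of descendants of `l`. -/
theorem odd_count_edges_iff (hT : IsRootedBinaryTree T)
    (hle : ∀ a b : V, a ≤ b ↔ ReflTransGen T.Adj a b) {k l : V} (hkl : T.Adj k l) {i j : V}
    (p : T.toSimpleGraphInclusive.Walk i j) :
    Odd (p.edges.count s(k, l)) ↔ Xor (l ≤ i) (l ≤ j) := by
  induction p with
  | nil => simp
  | @cons a b c h p ih =>
    have key : s(a, b) = s(k, l) ↔ Xor (l ≤ a) (l ≤ b) := by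
      have hk : ¬ l ≤ k := (hT.lt_of_adj hle hkl).not_ge
      have aux : ∀ x y : V, T.Adj x y → (s(x, y) = s(k, l) ↔ Xor (l ≤ x) (l ≤ y)) := by
        intro x y hxy
        have hlt := hT.lt_of_adj hle hxy
        constructor
        · intro he
          rcases Sym2.eq_iff.1 he with ⟨rfl, rfl⟩ | ⟨rfl, rfl⟩
          · exact Or.inr ⟨le_rfl, hk⟩
          · exact Or.inl ⟨le_rfl, hk⟩
        · rintro (⟨h1, h2⟩ | ⟨h1, h2⟩)
          · exact absurd (h1.trans hlt.le) h2
          · rcases h1.lt_or_eq with h3 | rfl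
            · exact absurd (hT.le_parent hle hxy h3) h2
            · rw [hT.parent_unique _ _ _ hxy hkl]
      rcases h.2 with h' | h'
      · exact aux a b h'
      · rw [Sym2.eq_swap, aux b a h', xor_comm]
    rw [Walk.edges_cons, List.count_cons]
    by_cases he : s(a, b) = s(k, l)
    · rw [if_pos (beq_iff_eq.2 he), Nat.odd_add_one, ih]
      have := key.1 he
      unfold Xor at *
      tauto
    · rw [if_neg fun h => he (beq_iff_eq.1 h), add_zero, ih]
      have := fun h => he (key.2 h)
      unfold Xor at *
      tauto

/-- A trail uses an edge at most once, so the parity of the count decides membership. Thus the edge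
set of a trail depends only on its end points. -/
theorem mem_edges_iff_of_isTrail (hT : IsRootedBinaryTree T)
    (hle : ∀ a b : V, a ≤ b ↔ ReflTransGen T.Adj a b) {k l : V} (hkl : T.Adj k l) {i j : V}
    {p : T.toSimpleGraphInclusive.Walk i j} (hp : p.IsTrail) :
    s(k, l) ∈ p.edges ↔ Xor (l ≤ i) (l ≤ j) := by
  classical
  rw [← odd_count_edges_iff hT hle hkl p]
  constructor
  · intro h
    rw [List.count_eq_one_of_mem hp.edges_nodup h]
    exact odd_one
  · intro h
    exact List.count_pos_iff.1 h.pos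

theorem isAcyclic_toSimpleGraphInclusive (hT : IsRootedBinaryTree T)
    (hle : ∀ a b : V, a ≤ b ↔ ReflTransGen T.Adj a b) : T.toSimpleGraphInclusive.IsAcyclic := by
  intro v c hc
  cases c with
  | nil => exact hc.ne_nil rfl
  | @cons _ b _ h p =>
    have hno : ∀ k l : V, T.Adj k l → s(k, l) ∉ (Walk.cons h p).edges := by
      intro k l hkl hmem
      exact (xor_self (l ≤ v)).le ((mem_edges_iff_of_isTrail hT hle hkl hc.isTrail).1 hmem)
    rcases h.2 with h' | h'
    · exact hno _ _ h' (by simp)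
    · exact hno _ _ h' (by simp [Sym2.eq_swap])

theorem connected_toSimpleGraphInclusive (hT : IsRootedBinaryTree T)
    (hle : ∀ a b : V, a ≤ b ↔ ReflTransGen T.Adj a b) (i j : V) :
    T.toSimpleGraphInclusive.Reachable i j := by
  obtain ⟨r, hr, hreach⟩ := hT.exists_root
  have aux : ∀ v, T.toSimpleGraphInclusive.Reachable r v := by
    intro v
    induction hreach v with
    | refl => rfl
    | tail _ h ih => exact ih.trans (Adj.reachable ⟨(hT.lt_of_adj hle h).ne, Or.inl h⟩)
  exact (aux i).symm.trans (aux j)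

/-- The top of a trek is the lowest common ancestor of its end points. -/
theorem Trek.top_eq_inf (hT : IsRootedBinaryTree T)
    (hle : ∀ a b : V, a ≤ b ↔ ReflTransGen T.Adj a b) {i j : V} (P : Trek T i j) :
    P.top = i ⊓ j := by
  classical
  have htrail : (P.path.takeUntil P.top P.top_mem).IsTrail := P.isPath.isTrail.takeUntil _
  have hsub := P.path.edges_takeUntil_subset_edges P.top_mem
  have hti : P.top ≤ i := by
    by_contra hi
    obtain ⟨k, hk⟩ := exists_parent_of_not_le hle hT hi
    exact P.top_isTop k hk (hsub ((mem_edges_iff_of_isTrail hT hle hk htrail).2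
      (Or.inr ⟨le_rfl, hi⟩)))
  have htj : P.top ≤ j := by
    by_contra hj
    obtain ⟨k, hk⟩ := exists_parent_of_not_le hle hT hj
    exact P.top_isTop k hk ((mem_edges_iff_of_isTrail hT hle hk P.isPath.isTrail).2
      (Or.inl ⟨hti, hj⟩))
  refine le_antisymm (le_inf hti htj) ?_
  by_contra hm
  obtain ⟨k, hk⟩ := exists_parent_of_not_le hle hT hm
  have h := hsub ((mem_edges_iff_of_isTrail hT hle hk htrail).2 (Or.inl ⟨inf_le_left, hm⟩))
  rcases (mem_edges_iff_of_isTrail hT hle hk P.isPath.isTrail).1 h with h' | h'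
  · exact h'.2 inf_le_right
  · exact h'.2 inf_le_left

theorem nonempty_trek (hT : IsRootedBinaryTree T)
    (hle : ∀ a b : V, a ≤ b ↔ ReflTransGen T.Adj a b) (i j : V) : Nonempty (Trek T i j) := by
  classical
  obtain ⟨p, hp⟩ := (connected_toSimpleGraphInclusive hT hle i j).exists_isPath
  refine ⟨⟨p, hp, fun a b k ha hb _ _ => hT.parent_unique _ _ _ ha hb, i ⊓ j, ?_, ?_⟩⟩
  · rcases (inf_le_left : i ⊓ j ≤ i).eq_or_lt with h | h
    · rw [h]
      exact p.start_mem_support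
    · obtain ⟨c, hc, hci⟩ := exists_child_of_lt hle h
      have hcj : ¬ c ≤ j := fun hcj => (hT.lt_of_adj hle hc).not_ge (le_inf hci hcj)
      exact p.fst_mem_support_of_mem_edges
        ((mem_edges_iff_of_isTrail hT hle hc hp.isTrail).2 (Or.inl ⟨hci, hcj⟩))
  · intro k hk h
    rcases (mem_edges_iff_of_isTrail hT hle hk hp.isTrail).1 h with h' | h'
    · exact h'.2 inf_le_right
    · exact h'.2 inf_le_left

open Classical in
/-- In a rooted tree there is exactly one trek between any two vertices. -/
theorem trekSum_eq [Finite V] [Fintype (Edge T)] (hT : IsRootedBinaryTree T)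
    (hle : ∀ a b : V, a ≤ b ↔ ReflTransGen T.Adj a b) (i j : V) :
    trekSum T i j = X (Sum.inl (i ⊓ j)) *
      ∏ e : Edge T, if Xor (e.1.2 ≤ i) (e.1.2 ≤ j) then X (Sum.inr e) else 1 := by
  obtain ⟨P⟩ := nonempty_trek hT hle i j
  have huniq : ∀ Q : Trek T i j, Q = P := by
    intro Q
    have h := ((isAcyclic_toSimpleGraphInclusive hT hle).subsingleton_path i j).elim
      (⟨Q.path, Q.isPath⟩ : T.toSimpleGraphInclusive.Path i j) ⟨P.path, P.isPath⟩
    ext1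
    · exact congrArg Subtype.val h
    · rw [Q.top_eq_inf hT hle, P.top_eq_inf hT hle]
  rw [trekSum, finsum_eq_single _ P fun Q hQ => absurd (huniq Q) hQ, Trek.monomial,
    P.top_eq_inf hT hle]
  congr 1
  rw [finprod_eq_prod_of_fintype]
  refine Finset.prod_congr rfl fun e _ => ?_
  rw [finprod_eq_if]
  exact if_congr (mem_edges_iff_of_isTrail hT hle e.2 P.isPath.isTrail) rfl rfl

end TrekSum

/-! ### Connecting monomials of the same shape by quadratic moves. -/

section Quadrics

variable {V ι : Type*} [SemilatticeInf V]

/-- A family `ℓ` of leaves of a tree (ordered by ancestry), with a binary planar structure: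
`R v i` says that the leaf `i` lies to the right of the vertex `v`, or is equal to `v`. -/
structure IsPlanarTree (ℓ : ι → V) (R : V → ι → Prop) : Prop where
  le_total_of_le : ∀ a b c : V, a ≤ c → b ≤ c → a ≤ b ∨ b ≤ a
  eq_of_le : ∀ i j : ι, ℓ i ≤ ℓ j → i = j
  right_self : ∀ i : ι, R (ℓ i) i
  le_of_right : ∀ (v : V) (i : ι), R v i → v ≤ ℓ i
  right_of_lt : ∀ (v x : V) (i j : ι), v < x → x ≤ ℓ i → x ≤ ℓ j → R v i → R v j
  right_inf_iff : ∀ i j : ι, i ≠ j → (R (ℓ i ⊓ ℓ j) i ↔ ¬ R (ℓ i ⊓ ℓ j) j)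

/-- The lowest common ancestor of a pair of leaves. -/
def lca (ℓ : ι → V) (s : Sym2 ι) : V := (s.map ℓ).inf

@[simp]
theorem lca_mk (ℓ : ι → V) (i j : ι) : lca ℓ s(i, j) = ℓ i ⊓ ℓ j := rfl

open Classical in
/-- The number of factors with the property `p` of the monomial with exponent `u`. -/
def tally {σ : Type*} (p : σ → Prop) : (σ →₀ ℕ) →+ ℕ :=
  Finsupp.weight fun s => if p s then 1 else 0

open Classical in
theorem tally_single {σ : Type*} (p : σ → Prop) (s : σ) (m : ℕ) :
    tally p (Finsupp.single s m) = if p s then m else 0 := by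
  simp [tally, Finsupp.weight_single]

theorem tally_ne_zero {σ : Type*} {p : σ → Prop} {u : σ →₀ ℕ} {s : σ} (hp : p s) (hs : u s ≠ 0) :
    tally p u ≠ 0 := by
  classical
  have h := Finsupp.le_weight (fun s => if p s then 1 else 0 : σ → ℕ) (s := s) (by simp [hp]) u
  unfold tally
  omega

theorem exists_of_tally_ne_zero {σ : Type*} {p : σ → Prop} {u : σ →₀ ℕ} (h : tally p u ≠ 0) :
    ∃ s, p s ∧ u s ≠ 0 := by
  classical
  rw [tally, Finsupp.weight_apply] at h
  obtain ⟨s, hs, h⟩ := Finset.exists_ne_zero_of_sum_ne_zero h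
  refine ⟨s, ?_, Finsupp.mem_support_iff.1 hs⟩
  by_contra hp
  simp [hp] at h

/-- Two exponents have the same number of factors with any given lowest common ancestor, and the
same number of off-diagonal factors at any given leaf. -/
def SameShape (ℓ : ι → V) (u u' : Sym2 ι →₀ ℕ) : Prop :=
  (∀ v, tally (fun s => lca ℓ s = v) u = tally (fun s => lca ℓ s = v) u') ∧
    ∀ i, tally (fun s => i ∈ s ∧ ¬ s.IsDiag) u = tally (fun s => i ∈ s ∧ ¬ s.IsDiag) u'

theorem SameShape.trans {ℓ : ι → V} {u u' u'' : Sym2 ι →₀ ℕ} (h : SameShape ℓ u u')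
    (h' : SameShape ℓ u' u'') : SameShape ℓ u u'' :=
  ⟨fun v => (h.1 v).trans (h'.1 v), fun i => (h.2 i).trans (h'.2 i)⟩

theorem SameShape.symm {ℓ : ι → V} {u u' : Sym2 ι →₀ ℕ} (h : SameShape ℓ u u') :
    SameShape ℓ u' u :=
  ⟨fun v => (h.1 v).symm, fun i => (h.2 i).symm⟩

theorem sameShape_add_left_iff {ℓ : ι → V} {w u u' : Sym2 ι →₀ ℕ} :
    SameShape ℓ (w + u) (w + u') ↔ SameShape ℓ u u' := by
  simp [SameShape]

/-- The ideal `K` contains the quadrics of all quartets of leaves `a, b | c, d` that are separated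
by an edge of the tree. -/
def ContainsQuadrics (ℓ : ι → V) (K : Ideal (MvPolynomial (Sym2 ι) ℂ)) : Prop :=
  ∀ (l : V) (a b c d : ι), l ≤ ℓ a → l ≤ ℓ b → ¬ l ≤ ℓ c → ¬ l ≤ ℓ d →
    (X s(a, c) * X s(b, d) - X s(a, d) * X s(b, c) : MvPolynomial (Sym2 ι) ℂ) ∈ K

variable {ℓ : ι → V} {R : V → ι → Prop}

/-- A vertex outside the subtree at `l` meets all of that subtree in the same ancestor of `l`. -/
theorem IsPlanarTree.inf_eq_inf (h : IsPlanarTree ℓ R) {l a b c : V} (ha : l ≤ a) (hb : l ≤ b)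
    (hc : ¬ l ≤ c) : a ⊓ c = b ⊓ c := by
  have aux : ∀ x y : V, l ≤ x → l ≤ y → x ⊓ c ≤ y ⊓ c := by
    intro x y hx hy
    refine le_inf ?_ inf_le_right
    rcases h.le_total_of_le _ _ x inf_le_left hx with h' | h'
    · exact h'.trans hy
    · exact absurd (h'.trans inf_le_right) hc
  exact le_antisymm (aux a b ha hb) (aux b a hb ha)

theorem IsPlanarTree.inf_lt (h : IsPlanarTree ℓ R) {l a c : V} (ha : l ≤ a)
    (hc : ¬ l ≤ c) : a ⊓ c < l := by
  rcases h.le_total_of_le _ _ a inf_le_left ha with h' | h'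
  · exact lt_of_le_of_ne h' fun he => hc (he ▸ inf_le_right)
  · exact absurd (h'.trans inf_le_right) hc

theorem IsPlanarTree.lca_eq_leaf (h : IsPlanarTree ℓ R) {s : Sym2 ι} {i : ι}
    (hs : lca ℓ s = ℓ i) : s = s(i, i) := by
  induction s with
  | _ a b =>
    rw [lca_mk] at hs
    rw [← h.eq_of_le i a (hs ▸ inf_le_left), ← h.eq_of_le i b (hs ▸ inf_le_right)]

/-- Of three leaves below `v`, two lie on the same side of `v`. -/
theorem IsPlanarTree.lt_inf_or_lt_inf (h : IsPlanarTree ℓ R) {v : V} {i a b : ι}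
    (hi : v ≤ ℓ i) (hab : ℓ a ⊓ ℓ b = v) (hne : a ≠ b) : v < ℓ i ⊓ ℓ a ∨ v < ℓ i ⊓ ℓ b := by
  have ha : v ≤ ℓ a := hab ▸ inf_le_left
  have hb : v ≤ ℓ b := hab ▸ inf_le_right
  by_contra! hcon
  have h1 : ℓ i ⊓ ℓ a = v := ((le_inf hi ha).eq_or_lt.resolve_right hcon.1).symm
  have h2 : ℓ i ⊓ ℓ b = v := ((le_inf hi hb).eq_or_lt.resolve_right hcon.2).symm
  have hia : i ≠ a := by
    rintro rfl
    rw [inf_idem] at h1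
    exact hne (h.eq_of_le _ _ (h1 ▸ hb))
  have hib : i ≠ b := by
    rintro rfl
    rw [inf_idem] at h2
    exact hne (h.eq_of_le _ _ (h2 ▸ ha)).symm
  have e1 := h.right_inf_iff i a hia
  have e2 := h.right_inf_iff i b hib
  have e3 := h.right_inf_iff a b hne
  rw [h1] at e1
  rw [h2] at e2
  rw [hab] at e3
  tauto

/-- One move that replaces the end `i'` of the factor `{i', j'}` by `i`. The degree condition
supplies an off-diagonal factor `{i, k}`, and `hno` puts `k` outside the subtree at `l`, so the
quadric of `i, i' | k, j'` applies. -/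
theorem IsPlanarTree.exists_swap (h : IsPlanarTree ℓ R) {K : Ideal (MvPolynomial (Sym2 ι) ℂ)}
    (hK : ContainsQuadrics ℓ K) {u : Sym2 ι →₀ ℕ} {l : V} {i i' j' : ι} (hi : l ≤ ℓ i)
    (hi' : l ≤ ℓ i') (hj' : ¬ l ≤ ℓ j') (hu : u s(i', j') ≠ 0)
    (hdeg : tally (fun s => i ∈ s ∧ ¬ s.IsDiag) u ≠ 0)
    (hno : ∀ k, k ≠ i → u s(i, k) ≠ 0 → ¬ l ≤ ℓ k) :
    ∃ u₁, monomial u 1 - monomial u₁ 1 ∈ K ∧ SameShape ℓ u u₁ ∧ u₁ s(i, j') ≠ 0 := by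
  classical
  rcases eq_or_ne i i' with rfl | hne
  · exact ⟨u, by simp, ⟨fun _ => rfl, fun _ => rfl⟩, hu⟩
  obtain ⟨s, ⟨his, hsd⟩, hus⟩ := exists_of_tally_ne_zero hdeg
  obtain ⟨k, rfl⟩ := his
  have hki : k ≠ i := fun e => hsd e.symm
  have hk := hno k hki hus
  have hij' : i ≠ j' := fun e => hj' (e ▸ hi)
  have hi'j' : i' ≠ j' := fun e => hj' (e ▸ hi')
  have hi'k : i' ≠ k := fun e => hk (e ▸ hi')
  have hss : s(i', j') ≠ s(i, k) := by
    intro e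
    rcases Sym2.eq_iff.1 e with ⟨e1, -⟩ | ⟨-, e1⟩
    · exact hne e1.symm
    · exact hij' e1.symm
  obtain ⟨w, rfl⟩ : ∃ w, u = Finsupp.single s(i, k) 1 + Finsupp.single s(i', j') 1 + w := by
    refine exists_add_of_le fun s => ?_
    rw [Finsupp.add_apply, Finsupp.single_apply, Finsupp.single_apply]
    split_ifs with h1 h2 h2
    · exact absurd (h2.trans h1.symm) hss
    · subst h1
      omega
    · subst h2
      omega
    · omega
  refine ⟨Finsupp.single s(i, j') 1 + Finsupp.single s(i', k) 1 + w, ?_, ⟨fun v => ?_, fun x => ?_⟩,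
    by simp⟩
  · have hm : ∀ s t : Sym2 ι, (monomial (Finsupp.single s 1 + Finsupp.single t 1 + w) 1 :
        MvPolynomial (Sym2 ι) ℂ) = X s * X t * monomial w 1 := by
      intro s t
      simp [X, monomial_mul]
    rw [hm, hm, ← sub_mul]
    exact K.mul_mem_right _ (hK l i i' k j' hi hi' hk hj')
  · have e₁ : lca ℓ s(i, k) = lca ℓ s(i', k) := h.inf_eq_inf hi hi' hk
    have e₂ : lca ℓ s(i, j') = lca ℓ s(i', j') := h.inf_eq_inf hi hi' hj'
    simp only [map_add, tally_single, e₁, e₂]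
    omega
  · simp only [map_add, tally_single, Sym2.mem_iff, Sym2.mk_isDiag_iff, hki.symm, hij', hi'j', hi'k,
      not_false_eq_true, and_true]
    have : x = i → x = i' → False := fun a b => hne (a.symm.trans b)
    grind

/-- Take a factor `{i, j}` of `u'` whose lowest common ancestor is as deep as possible. By equality
of shapes, `u` has a factor `{i', j'}` with the same ancestor; two swaps, one on each side of it,
turn this factor into `{i, j}`. Maximality excludes factors with a deeper ancestor, which is what
`exists_swap` needs. -/
theorem IsPlanarTree.exists_common_factor (h : IsPlanarTree ℓ R)
    {K : Ideal (MvPolynomial (Sym2 ι) ℂ)} (hK : ContainsQuadrics ℓ K) {u u' : Sym2 ι →₀ ℕ}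
    (huu : SameShape ℓ u u') (hu' : u' ≠ 0) :
    ∃ u₁ s, monomial u 1 - monomial u₁ 1 ∈ K ∧ SameShape ℓ u₁ u' ∧ u₁ s ≠ 0 ∧ u' s ≠ 0 := by
  classical
  obtain ⟨s, hs, hmax⟩ := Finset.exists_maximalFor (lca ℓ) u'.support
    (Finsupp.support_nonempty_iff.2 hu')
  rw [Finsupp.mem_support_iff] at hs
  have hno : ∀ u₂, SameShape ℓ u₂ u' → ∀ t, lca ℓ s < lca ℓ t → u₂ t = 0 := by
    intro u₂ h₂ t ht
    by_contra hne
    have hcnt := tally_ne_zero (p := fun x => lca ℓ x = lca ℓ t) rfl hne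
    rw [h₂.1] at hcnt
    obtain ⟨t', ht', hut'⟩ := exists_of_tally_ne_zero hcnt
    exact ht.not_ge (ht' ▸ hmax (Finsupp.mem_support_iff.2 hut') (ht' ▸ ht.le))
  have hcnt := tally_ne_zero (p := fun x => lca ℓ x = lca ℓ s) rfl hs
  rw [← huu.1] at hcnt
  obtain ⟨t, ht, hut⟩ := exists_of_tally_ne_zero hcnt
  induction s with
  | _ i j =>
  rcases eq_or_ne i j with rfl | hij
  -- A factor whose common ancestor is a leaf can only be the diagonal one, so no move is needed.
  · rw [lca_mk, inf_idem] at ht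
    obtain rfl := h.lca_eq_leaf ht
    exact ⟨u, _, by simp, huu, hut, hs⟩
  have hdeg : ∀ x ∈ s(i, j), ∀ u₂, SameShape ℓ u₂ u' →
      tally (fun s => x ∈ s ∧ ¬ s.IsDiag) u₂ ≠ 0 := by
    intro x hx u₂ h₂
    have hnd : ¬ s(i, j).IsDiag := by rwa [Sym2.mk_isDiag_iff]
    rw [h₂.2 x]
    exact tally_ne_zero (p := fun s : Sym2 ι => x ∈ s ∧ ¬ s.IsDiag) ⟨hx, hnd⟩ hs
  obtain ⟨i', j', rfl, hlt⟩ : ∃ i' j', t = s(i', j') ∧ ℓ i ⊓ ℓ j < ℓ i ⊓ ℓ i' := by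
    induction t with
    | _ a b =>
    have hab : a ≠ b := by
      rintro rfl
      rw [lca_mk, lca_mk, inf_idem] at ht
      exact hij ((h.eq_of_le _ _ (ht ▸ inf_le_left)).symm.trans (h.eq_of_le _ _ (ht ▸ inf_le_right)))
    rcases h.lt_inf_or_lt_inf (i := i) (inf_le_left : ℓ i ⊓ ℓ j ≤ _) ht hab with h' | h'
    · exact ⟨a, b, rfl, h'⟩
    · exact ⟨b, a, Sym2.eq_swap, h'⟩
  simp only [lca_mk] at ht hno
  have hi'j' : i' ≠ j' := by
    rintro rfl
    rw [inf_idem] at ht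
    exact hij ((h.eq_of_le _ _ (ht ▸ inf_le_left)).symm.trans (h.eq_of_le _ _ (ht ▸ inf_le_right)))
  obtain ⟨u₁, hu₁, hs₁, hn₁⟩ := h.exists_swap hK (l := ℓ i ⊓ ℓ i') inf_le_left inf_le_right
    (j' := j') (fun hle => hlt.not_ge (ht ▸ le_inf inf_le_right hle)) hut
    (hdeg i (Sym2.mem_mk_left _ _) _ huu) fun k _ huk hle =>
      huk (hno u huu s(i, k) (hlt.trans_le (le_inf inf_le_left hle)))
  have hs₁' := hs₁.symm.trans huu
  -- Since `i'` is on the side of `i`, the leaf `j` must share its side with `j'`.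
  have hlt' : ℓ i ⊓ ℓ j < ℓ j ⊓ ℓ j' := by
    refine (h.lt_inf_or_lt_inf (i := j) inf_le_right ht hi'j').resolve_left fun h' => ?_
    rcases h.le_total_of_le _ _ (ℓ i') (inf_le_right : ℓ i ⊓ ℓ i' ≤ _)
      (inf_le_right : ℓ j ⊓ ℓ i' ≤ _) with h'' | h''
    · exact hlt.not_ge (le_inf inf_le_left (h''.trans inf_le_left))
    · exact h'.not_ge (le_inf (h''.trans inf_le_left) inf_le_left)
  obtain ⟨u₂, hu₂, hs₂, hn₂⟩ := h.exists_swap hK (l := ℓ j ⊓ ℓ j') (i := j) (i' := j') (j' := i)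
    inf_le_left inf_le_right (fun hle => hlt'.not_ge (le_inf hle inf_le_left))
    (Sym2.eq_swap (a := i) ▸ hn₁) (hdeg j (Sym2.mem_mk_right _ _) _ hs₁') fun k _ huk hle =>
      huk (hno u₁ hs₁' s(j, k) (hlt'.trans_le (le_inf inf_le_left hle)))
  refine ⟨u₂, s(i, j), ?_, hs₂.symm.trans hs₁', Sym2.eq_swap (a := j) ▸ hn₂, hs⟩
  simpa using K.add_mem hu₁ hu₂

/-- Induction on the degree: produce a common factor, cancel it, and note that shape is additive. -/
theorem IsPlanarTree.monomial_sub_mem (h : IsPlanarTree ℓ R)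
    {K : Ideal (MvPolynomial (Sym2 ι) ℂ)} (hK : ContainsQuadrics ℓ K) {u u' : Sym2 ι →₀ ℕ}
    (huu : SameShape ℓ u u') : monomial u 1 - monomial u' 1 ∈ K := by
  induction hN : u'.degree generalizing u u' with
  | zero =>
    rw [Finsupp.degree_eq_zero_iff] at hN
    subst hN
    obtain rfl : u = 0 := by
      ext s
      by_contra hne
      exact tally_ne_zero (p := fun x => lca ℓ x = lca ℓ s) rfl hne (by rw [huu.1, map_zero])
    simp
  | succ N ih =>
    have hu' : u' ≠ 0 := by
      rintro rfl
      simp at hN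
    obtain ⟨u₁, s, hu₁, hs₁, hn₁, hn⟩ := h.exists_common_factor hK huu hu'
    have hex : ∀ w : Sym2 ι →₀ ℕ, w s ≠ 0 → ∃ w', w = Finsupp.single s 1 + w' := fun w hw =>
      exists_add_of_le (Finsupp.single_le_iff.2 (Nat.one_le_iff_ne_zero.2 hw))
    obtain ⟨w₁, rfl⟩ := hex _ hn₁
    obtain ⟨w, rfl⟩ := hex _ hn
    rw [sameShape_add_left_iff] at hs₁
    have hw := ih hs₁ (by simpa [add_comm 1] using hN)
    have hm : ∀ w : Sym2 ι →₀ ℕ, (monomial (Finsupp.single s 1 + w) 1 :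
        MvPolynomial (Sym2 ι) ℂ) = X s * monomial w 1 := by
      intro w
      simp [X, monomial_mul]
    have := K.add_mem hu₁ (K.mul_mem_left (X s) hw)
    rw [mul_sub, ← hm, ← hm] at this
    simpa using this

end Quadrics

/-! ### Kernels of monomial maps. -/

section MonomialMap

variable {σ κ : Type*}

/-- The exponent of the image of a monomial under the monomial map with exponents `A`. -/
def expMap (A : σ → κ →₀ ℕ) : (σ →₀ ℕ) →+ (κ →₀ ℕ) := Finsupp.weight A

/-- The homomorphism of polynomial rings that sends each `x_s` to the monomial `y ^ (A s)`. -/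
def monomialMap (A : σ → κ →₀ ℕ) : MvPolynomial σ ℂ →ₐ[ℂ] MvPolynomial κ ℂ :=
  aeval fun s => monomial (A s) 1

theorem monomialMap_monomial (A : σ → κ →₀ ℕ) (u : σ →₀ ℕ) (c : ℂ) :
    monomialMap A (monomial u c) = monomial (expMap A u) c := by
  simp_rw [monomialMap, aeval_monomial, expMap, Finsupp.weight_apply, Finsupp.sum, Finsupp.prod,
    algebraMap_eq, monomial_pow, one_pow, ← monomial_sum_one, C_mul_monomial, mul_one]

/-- The kernel of a monomial map is spanned by binomials. -/
theorem ker_monomialMap_le (A : σ → κ →₀ ℕ) {K : Ideal (MvPolynomial σ ℂ)}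
    (hK : ∀ u u', expMap A u = expMap A u' → monomial u 1 - monomial u' 1 ∈ K) :
    RingHom.ker (monomialMap A) ≤ K := by
  intro f hf
  -- `r` picks one preimage of each exponent in the image, and `L` is its linear extension. Modulo
  -- `K` every `g` equals `L` of its image, which is zero on the kernel.
  let r : (κ →₀ ℕ) → (σ →₀ ℕ) := Function.invFun (expMap A)
  let L : MvPolynomial κ ℂ →ₗ[ℂ] MvPolynomial σ ℂ :=
    (basisMonomials κ ℂ).constr ℂ fun m => monomial (r m) 1
  have hL : ∀ m c, L (monomial m c) = monomial (r m) c := by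
    intro m c
    have := (basisMonomials κ ℂ).constr_basis ℂ (fun m => (monomial (r m) 1 : MvPolynomial σ ℂ)) m
    rw [coe_basisMonomials] at this
    rw [← mul_one c, ← smul_eq_mul, ← smul_monomial, map_smul, this, smul_monomial]
  have hg : ∀ g : MvPolynomial σ ℂ, g - L (monomialMap A g) ∈ K := by
    intro g
    induction g using MvPolynomial.induction_on' with
    | monomial u c =>
      rw [monomialMap_monomial, hL]
      have := K.mul_mem_left (C c)
        (hK u _ (Function.invFun_eq (f := expMap A) ⟨u, rfl⟩).symm)
      rwa [mul_sub, C_mul_monomial, C_mul_monomial, mul_one] at this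
    | add p q hp hq =>
      rw [map_add, map_add, add_sub_add_comm]
      exact K.add_mem hp hq
  simpa [RingHom.mem_ker.1 hf] using hg f

end MonomialMap

/-! ### Membership in the Grassmannian ideal. -/

section Minors

variable {n : ℕ}

/-- The Plücker coordinates of the `2 × n` matrix with rows `u` and `v`, together with the free
diagonal coordinates `w`. -/
def minor {A : Type*} [CommRing A] (u v w : Fin n → A) (s : Sym2 (Fin n)) : A :=
  if s.IsDiag then w s.inf else u s.inf * v s.sup - u s.sup * v s.inf

theorem map_minor {A B F : Type*} [CommRing A] [CommRing B] [FunLike F A B] [RingHomClass F A B]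
    (f : F) (u v w : Fin n → A) (s : Sym2 (Fin n)) :
    f (minor u v w s) = minor (fun i => f (u i)) (fun i => f (v i)) (fun i => f (w i)) s := by
  unfold minor
  split_ifs <;> simp

theorem minor_diag {A : Type*} [CommRing A] (u v w : Fin n → A) (i : Fin n) :
    minor u v w s(i, i) = w i := by
  simp [minor]

theorem minor_of_lt {A : Type*} [CommRing A] (u v w : Fin n → A) {i j : Fin n} (h : i < j) :
    minor u v w s(i, j) = u i * v j - u j * v i := by
  simp [minor, h.ne, h.le]

theorem mem_grassmannianIdeal_iff {f : MvPolynomial (Sym2 (Fin n)) ℂ} :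
    f ∈ grassmannianIdeal n ↔ ∀ u v w : Fin n → ℂ, aeval (minor u v w) f = 0 := by
  rw [grassmannianIdeal, mem_vanishingIdeal_iff]
  constructor
  · intro h u v w
    refine h _ ⟨Matrix.of ![u, v], fun i j hij => ?_⟩
    rw [minor_of_lt _ _ _ hij, Matrix.det_fin_two]
    simp
  · rintro h p ⟨A, hA⟩
    convert h (A 0) (A 1) (fun i => p s(i, i)) using 2
    congr 1
    ext s
    induction s with
    | _ i j =>
    rcases lt_trichotomy i j with hij | rfl | hij
    · rw [minor_of_lt _ _ _ hij, hA i j hij, Matrix.det_fin_two]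
      simp
    · rw [minor_diag]
    · rw [Sym2.eq_swap, minor_of_lt _ _ _ hij, hA j i hij, Matrix.det_fin_two]
      simp

/-- The elements of the Grassmannian ideal vanish on the minors of a matrix with entries in an
arbitrary algebra. -/
theorem aeval_minor_eq_zero {f : MvPolynomial (Sym2 (Fin n)) ℂ} (hf : f ∈ grassmannianIdeal n)
    {A : Type*} [CommRing A] [Algebra ℂ A] (u v w : Fin n → A) : aeval (minor u v w) f = 0 := by
  let U : Fin n → MvPolynomial (Fin n ⊕ Fin n ⊕ Fin n) ℂ := fun i => X (Sum.inl i)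
  let V : Fin n → MvPolynomial (Fin n ⊕ Fin n ⊕ Fin n) ℂ := fun i => X (Sum.inr (Sum.inl i))
  let W : Fin n → MvPolynomial (Fin n ⊕ Fin n ⊕ Fin n) ℂ := fun i => X (Sum.inr (Sum.inr i))
  have hgen : aeval (minor U V W) f = 0 := by
    refine MvPolynomial.funext fun x => ?_
    rw [map_zero, ← coe_aeval_eq_eval, RingHom.coe_coe, ← AlgHom.comp_apply, comp_aeval]
    simp_rw [map_minor]
    exact mem_grassmannianIdeal_iff.1 hf _ _ _
  have := congrArg (aeval (Sum.elim u (Sum.elim v w)) : _ →ₐ[ℂ] A) hgen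
  rw [map_zero, ← AlgHom.comp_apply, comp_aeval] at this
  simp_rw [map_minor] at this
  simpa [U, V, W] using this

/-- It suffices to test membership in the Grassmannian ideal on matrices without zeros in the first
row. -/
theorem mem_grassmannianIdeal_of_ne_zero {f : MvPolynomial (Sym2 (Fin n)) ℂ}
    (hf : ∀ u v w : Fin n → ℂ, (∀ i, u i ≠ 0) → aeval (minor u v w) f = 0) :
    f ∈ grassmannianIdeal n := by
  let U : Fin n → MvPolynomial (Fin n ⊕ Fin n ⊕ Fin n) ℂ := fun i => X (Sum.inl i)
  let V : Fin n → MvPolynomial (Fin n ⊕ Fin n ⊕ Fin n) ℂ := fun i => X (Sum.inr (Sum.inl i))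
  let W : Fin n → MvPolynomial (Fin n ⊕ Fin n ⊕ Fin n) ℂ := fun i => X (Sum.inr (Sum.inr i))
  have heval : ∀ x : Fin n ⊕ Fin n ⊕ Fin n → ℂ, eval x (aeval (minor U V W) f) =
      aeval (minor (fun i => x (Sum.inl i)) (fun i => x (Sum.inr (Sum.inl i)))
        (fun i => x (Sum.inr (Sum.inr i)))) f := by
    intro x
    rw [← coe_aeval_eq_eval, RingHom.coe_coe, ← AlgHom.comp_apply, comp_aeval]
    simp_rw [map_minor]
    simp [U, V, W]
  have hgen : aeval (minor U V W) f = 0 := by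
    refine MvPolynomial.funext_set (fun _ => {0}ᶜ) (fun _ => (Set.finite_singleton 0).infinite_compl)
      fun x hx => ?_
    rw [map_zero, heval]
    exact hf _ _ _ fun i => hx (Sum.inl i) trivial
  refine mem_grassmannianIdeal_iff.2 fun u v w => ?_
  have := heval (Sum.elim u (Sum.elim v w))
  rw [hgen, map_zero] at this
  simpa using this.symm

end Minors

/-! ### Signs and weights in the three-term Plücker relations. -/

section Signs

variable {V : Type*} [SemilatticeInf V] {n : ℕ}

open Classical in
/-- The sign of the pair `(i, j)` in the planar structure `R`. -/
def side (ℓ : Fin n → V) (R : V → Fin n → Prop) (i j : Fin n) : ℤˣ :=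
  if R (ℓ i ⊓ ℓ j) j then 1 else -1

/-- The sign vector that compares the planar structure `R` with the labeling of the leaves. -/
def signVector (ℓ : Fin n → V) (R : V → Fin n → Prop) (s : Sym2 (Fin n)) : ℤˣ :=
  if s.IsDiag then 1 else side ℓ R s.inf s.sup

variable {ℓ : Fin n → V} {R : V → Fin n → Prop}

theorem IsPlanarTree.side_swap (h : IsPlanarTree ℓ R) {i j : Fin n} (hij : i ≠ j) :
    side ℓ R j i = - side ℓ R i j := by
  have := h.right_inf_iff i j hij
  unfold side
  rw [inf_comm (ℓ j)]
  by_cases hR : R (ℓ i ⊓ ℓ j) j <;> simp_all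

/-- Both the side and the minor change sign when `i` and `j` are exchanged, so the signed coordinate
can be computed in either order, regardless of the labeling. -/
theorem IsPlanarTree.signVector_mul_minor (h : IsPlanarTree ℓ R) {A : Type*} [CommRing A]
    (u v w : Fin n → A) {i j : Fin n} (hij : i ≠ j) :
    ((signVector ℓ R s(i, j) : ℤ) : A) * minor u v w s(i, j) =
      ((side ℓ R i j : ℤ) : A) * (u i * v j - u j * v i) := by
  rcases lt_or_gt_of_ne hij with hlt | hlt
  · simp [minor_of_lt _ _ _ hlt, signVector, hij, hlt.le]
  · rw [Sym2.eq_swap, minor_of_lt _ _ _ hlt, h.side_swap hij.symm]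
    simp [signVector, hij.symm, hlt.le]
    ring

/-- The sign of the non-initial term of a three-term Plücker relation in the signed coordinates. -/
def pluckerSign (ℓ : Fin n → V) (R : V → Fin n → Prop) (a b c d : Fin n) : ℤ :=
  (side ℓ R a c * side ℓ R a d * side ℓ R a b * side ℓ R c d : ℤˣ)

/-- The three-term Plücker relations in the signed coordinates. -/
theorem IsPlanarTree.signed_plucker (h : IsPlanarTree ℓ R) {l : V} {a b c d : Fin n}
    (ha : l ≤ ℓ a) (hb : l ≤ ℓ b) (hc : ¬ l ≤ ℓ c) (hd : ¬ l ≤ ℓ d) (hab : a ≠ b) (hcd : c ≠ d)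
    {A : Type*} [CommRing A] (u v w : Fin n → A) (M : Sym2 (Fin n) → A)
    (hM : ∀ s, M s = ((signVector ℓ R s : ℤ) : A) * minor u v w s) :
    M s(a, c) * M s(b, d) - M s(a, d) * M s(b, c) =
      (pluckerSign ℓ R a b c d : A) * (M s(a, b) * M s(c, d)) := by
  have hac : a ≠ c := fun e => hc (e ▸ ha)
  have had : a ≠ d := fun e => hd (e ▸ ha)
  have hbc : b ≠ c := fun e => hc (e ▸ hb)
  have hbd : b ≠ d := fun e => hd (e ▸ hb)
  -- The side depends only on the common ancestor and the second leaf, so both products on the left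
  -- carry the same sign.
  have e₁ : side ℓ R b c = side ℓ R a c := by
    unfold side
    rw [h.inf_eq_inf ha hb hc]
  have e₂ : side ℓ R b d = side ℓ R a d := by
    unfold side
    rw [h.inf_eq_inf ha hb hd]
  simp only [hM, h.signVector_mul_minor u v w hac, h.signVector_mul_minor u v w had,
    h.signVector_mul_minor u v w hbc, h.signVector_mul_minor u v w hbd,
    h.signVector_mul_minor u v w hab, h.signVector_mul_minor u v w hcd, e₁, e₂]
  have hsq : ∀ x : ℤˣ, ((x : ℤ) : A) * ((x : ℤ) : A) = 1 := by
    intro x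
    rw [← Int.cast_mul, ← Units.val_mul, Int.units_mul_self]
    simp
  have h₁ := hsq (side ℓ R a b)
  have h₂ := hsq (side ℓ R c d)
  unfold pluckerSign
  push_cast
  generalize ((side ℓ R a b : ℤ) : A) = x at *
  generalize ((side ℓ R c d : ℤ) : A) = y at *
  linear_combination (-((side ℓ R a c : ℤ) : A) * ((side ℓ R a d : ℤ) : A) *
    (u a * v b - u b * v a) * (u c * v d - u d * v c)) * (y * y * h₁ + h₂)

/-- The ancestors of `a, c` and of `a, d` are comparable; the higher one lies weakly above that of
`c, d`, and the other one strictly above that of `a, b`. -/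
theorem IsPlanarTree.weight_lt (h : IsPlanarTree ℓ R) {δ : V → ℕ} (hδ : StrictMono δ) {l : V}
    {a b c d : Fin n} (ha : l ≤ ℓ a) (hb : l ≤ ℓ b) (hc : ¬ l ≤ ℓ c) (hd : ¬ l ≤ ℓ d) :
    δ (lca ℓ s(a, c)) + δ (lca ℓ s(b, d)) < δ (lca ℓ s(a, b)) + δ (lca ℓ s(c, d)) := by
  simp only [lca_mk]
  rw [← h.inf_eq_inf ha hb hd]
  have h₁ : ℓ a ⊓ ℓ c < ℓ a ⊓ ℓ b := (h.inf_lt ha hc).trans_le (le_inf ha hb)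
  have h₂ : ℓ a ⊓ ℓ d < ℓ a ⊓ ℓ b := (h.inf_lt ha hd).trans_le (le_inf ha hb)
  rcases h.le_total_of_le (ℓ a ⊓ ℓ c) (ℓ a ⊓ ℓ d) (ℓ a) inf_le_left inf_le_left with h' | h'
  · have := hδ.monotone (le_inf inf_le_right (h'.trans inf_le_right) : ℓ a ⊓ ℓ c ≤ ℓ c ⊓ ℓ d)
    have := hδ h₂
    omega
  · have := hδ.monotone (le_inf (h'.trans inf_le_right) inf_le_right : ℓ a ⊓ ℓ d ≤ ℓ c ⊓ ℓ d)
    have := hδ h₁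
    omega

theorem IsPlanarTree.lca_add_eq (h : IsPlanarTree ℓ R) {M : Type*} [AddCommMonoid M] (δ : V → M)
    {l : V} {a b c d : Fin n}
    (ha : l ≤ ℓ a) (hb : l ≤ ℓ b) (hc : ¬ l ≤ ℓ c) (hd : ¬ l ≤ ℓ d) :
    δ (lca ℓ s(a, d)) + δ (lca ℓ s(b, c)) = δ (lca ℓ s(a, c)) + δ (lca ℓ s(b, d)) := by
  simp only [lca_mk]
  rw [h.inf_eq_inf ha hb hd, h.inf_eq_inf ha hb hc, add_comm]

end Signs

/-! ### The parametrized family over the affine line. -/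

section Family

variable {V : Type*} [SemilatticeInf V] {n : ℕ}

/-- The parameters `b_v`, `x_i`, `z_i` of the family. -/
abbrev FamilyParam (V : Type*) (n : ℕ) : Type _ := V ⊕ Fin n ⊕ Fin n

open Classical in
/-- The coefficient of `b_v` in the difference of the `j`-th and the `i`-th affine coordinate. -/
def rightDiff (R : V → Fin n → Prop) (i j : Fin n) (v : V) : ℤ :=
  (if R v j then 1 else 0) - (if R v i then 1 else 0)

open Classical in
/-- The affine coordinates `y_i = ∑ b_v t ^ δ(v)`, the sum over all `v` with `i` to the right. -/
def affineCoord [Fintype V] (R : V → Fin n → Prop) (δ : V → ℕ) (i : Fin n) :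
    MvPolynomial (FamilyParam V n) (Polynomial ℂ) :=
  ∑ v, C (Polynomial.X ^ δ v * if R v i then 1 else 0) * X (Sum.inl v)

/-- The coordinates of the generic point of the family: up to the sign and a power of `t`, these are
the Plücker coordinates of the matrix with columns `(x_i, x_i y_i)`. -/
def familyCoord [Fintype V] (ℓ : Fin n → V) (R : V → Fin n → Prop) (δ : V → ℕ) (s : Sym2 (Fin n)) :
    MvPolynomial (FamilyParam V n) (Polynomial ℂ) :=
  if s.IsDiag then X (Sum.inr (Sum.inr s.inf)) ^ 3 else
    X (Sum.inr (Sum.inl s.inf)) * X (Sum.inr (Sum.inl s.sup)) *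
      ∑ v, C (((signVector ℓ R s * rightDiff R s.inf s.sup v : ℤ) : Polynomial ℂ) *
        Polynomial.X ^ (δ v - δ (lca ℓ s))) * X (Sum.inl v)

/-- The exponents of the special fibre of the family. -/
def specialExp (ℓ : Fin n → V) (s : Sym2 (Fin n)) : FamilyParam V n →₀ ℕ :=
  if s.IsDiag then Finsupp.single (Sum.inr (Sum.inr s.inf)) 3 else
    Finsupp.single (Sum.inr (Sum.inl s.inf)) 1 + Finsupp.single (Sum.inr (Sum.inl s.sup)) 1 +
      Finsupp.single (Sum.inl (lca ℓ s)) 1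

variable {ℓ : Fin n → V} {R : V → Fin n → Prop} {δ : V → ℕ}

/-- If one of the leaves is to the right of `v`, then `v` is comparable with their common ancestor,
and `δ` forces it strictly above. Both leaves are then on the same side of `v`, and the coefficients
cancel. -/
theorem IsPlanarTree.rightDiff_eq_zero (h : IsPlanarTree ℓ R) (hδ : StrictMono δ) {i j : Fin n}
    {v : V} (hv : v ≠ ℓ i ⊓ ℓ j) (hle : δ v ≤ δ (ℓ i ⊓ ℓ j)) : rightDiff R i j v = 0 := by
  have aux : ∀ x y, ℓ x ⊓ ℓ y = ℓ i ⊓ ℓ j → R v x → R v y := by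
    intro x y hxy hx
    have hlt : v < ℓ x ⊓ ℓ y := by
      rw [hxy]
      refine lt_of_le_of_ne ?_ hv
      rcases h.le_total_of_le v (ℓ i ⊓ ℓ j) (ℓ x) (h.le_of_right _ _ hx) (hxy ▸ inf_le_left)
        with h' | h'
      · exact h'
      · exact absurd hle (hδ (lt_of_le_of_ne h' hv.symm)).not_ge
    exact h.right_of_lt v _ x y hlt inf_le_left inf_le_right hx
  have : R v i ↔ R v j := ⟨aux i j rfl, aux j i (inf_comm _ _)⟩
  by_cases hi : R v i
  · simp [rightDiff, hi, this.1 hi]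
  · simp [rightDiff, hi, mt this.2 hi]

theorem IsPlanarTree.rightDiff_inf (h : IsPlanarTree ℓ R) {i j : Fin n} (hij : i ≠ j) :
    rightDiff R i j (ℓ i ⊓ ℓ j) = side ℓ R i j := by
  have := h.right_inf_iff i j hij
  unfold rightDiff side
  by_cases hR : R (ℓ i ⊓ ℓ j) j <;> simp_all

variable [Fintype V]

/-- The cube on the diagonal matches the degree of `x_i x_j b_v`; the common degree makes the kernel
homogeneous. -/
theorem isHomogeneous_familyCoord (ℓ : Fin n → V) (R : V → Fin n → Prop) (δ : V → ℕ)
    (s : Sym2 (Fin n)) : (familyCoord ℓ R δ s).IsHomogeneous 3 := by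
  unfold familyCoord
  split_ifs
  · exact isHomogeneous_X_pow _ _
  · refine ((isHomogeneous_X _ _).mul (isHomogeneous_X _ _)).mul
      (IsHomogeneous.sum _ _ 1 fun v _ => ?_)
    exact isHomogeneous_C_mul_X _ _

open Classical in
theorem IsPlanarTree.pow_mul_familyCoord (h : IsPlanarTree ℓ R) (hδ : StrictMono δ)
    (s : Sym2 (Fin n)) :
    C (Polynomial.X ^ δ (lca ℓ s)) * familyCoord ℓ R δ s = ((signVector ℓ R s : ℤ) :
      MvPolynomial (FamilyParam V n) (Polynomial ℂ)) *
        minor (fun i => X (Sum.inr (Sum.inl i)))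
          (fun i => X (Sum.inr (Sum.inl i)) * affineCoord R δ i)
          (fun i => C (Polynomial.X ^ δ (ℓ i)) * X (Sum.inr (Sum.inr i)) ^ 3) s := by
  induction s with
  | _ i j =>
  wlog hle : i ≤ j generalizing i j
  · rw [Sym2.eq_swap]
    exact this j i (le_of_not_ge hle)
  rcases hle.eq_or_lt with rfl | hlt
  · simp [familyCoord, minor_diag, signVector]
  rw [minor_of_lt _ _ _ hlt]
  have key : C (Polynomial.X ^ δ (lca ℓ s(i, j))) *
      ∑ v, C (((signVector ℓ R s(i, j) * rightDiff R i j v : ℤ) : Polynomial ℂ) *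
        Polynomial.X ^ (δ v - δ (lca ℓ s(i, j)))) * X (Sum.inl v) =
      ((signVector ℓ R s(i, j) : ℤ) : MvPolynomial (FamilyParam V n) (Polynomial ℂ)) *
        (affineCoord R δ j - affineCoord R δ i) := by
    rw [affineCoord, affineCoord, ← Finset.sum_sub_distrib, Finset.mul_sum, Finset.mul_sum]
    refine Finset.sum_congr rfl fun v _ => ?_
    rw [← sub_mul, ← C_sub, ← mul_sub, ← mul_assoc, ← C_mul]
    have hd : Polynomial.X ^ δ (lca ℓ s(i, j)) * (((signVector ℓ R s(i, j) * rightDiff R i j v : ℤ) :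
        Polynomial ℂ) * Polynomial.X ^ (δ v - δ (lca ℓ s(i, j)))) =
        ((signVector ℓ R s(i, j) : ℤ) : Polynomial ℂ) *
          (Polynomial.X ^ δ v * ((rightDiff R i j v : ℤ) : Polynomial ℂ)) := by
      by_cases h0 : rightDiff R i j v = 0
      · simp [h0]
      -- The truncated subtraction in the exponent is exact wherever the coefficient is nonzero.
      · have hle : δ (lca ℓ s(i, j)) ≤ δ v := by
          by_contra hcon
          refine h0 (h.rightDiff_eq_zero hδ ?_ (not_le.1 hcon).le)
          rintro rfl
          exact hcon le_rfl
        rw [← Nat.add_sub_cancel' hle]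
        simp only [Nat.add_sub_cancel_left, pow_add]
        push_cast
        ring
    rw [hd]
    have hr : ((rightDiff R i j v : ℤ) : Polynomial ℂ) =
        (if R v j then 1 else 0) - (if R v i then 1 else 0) := by
      simp [rightDiff]
    rw [hr]
    simp only [C_mul, map_intCast]
    ring
  have hfc : familyCoord ℓ R δ s(i, j) = X (Sum.inr (Sum.inl i)) * X (Sum.inr (Sum.inl j)) *
      ∑ v, C (((signVector ℓ R s(i, j) * rightDiff R i j v : ℤ) : Polynomial ℂ) *
        Polynomial.X ^ (δ v - δ (lca ℓ s(i, j)))) * X (Sum.inl v) := by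
    simp only [familyCoord, Sym2.mk_isDiag_iff, hlt.ne, if_false, Sym2.inf_mk, Sym2.sup_mk,
      inf_eq_left.2 hlt.le, sup_eq_right.2 hlt.le]
  rw [hfc]
  linear_combination (X (Sum.inr (Sum.inl i)) * X (Sum.inr (Sum.inl j))) * key

/-- At `t = 0` only the term of the common ancestor survives, and the sign vector makes its
coefficient `1`. -/
theorem IsPlanarTree.map_familyCoord_zero (h : IsPlanarTree ℓ R) (hδ : StrictMono δ)
    (s : Sym2 (Fin n)) :
    MvPolynomial.map (Polynomial.evalRingHom 0) (familyCoord ℓ R δ s) =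
      monomial (specialExp ℓ s) 1 := by
  induction s with
  | _ i j =>
  wlog hle : i ≤ j generalizing i j
  · rw [Sym2.eq_swap]
    exact this j i (le_of_not_ge hle)
  rcases hle.eq_or_lt with rfl | hlt
  · simp [familyCoord, specialExp, X_pow_eq_monomial]
  have hnd : ¬ s(i, j).IsDiag := hlt.ne
  simp only [familyCoord, specialExp, if_neg hnd, Sym2.inf_mk, Sym2.sup_mk,
      inf_eq_left.2 hlt.le, sup_eq_right.2 hlt.le, map_mul, map_X, map_sum, map_C]
  rw [Finset.sum_eq_single (lca ℓ s(i, j))]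
  · have hsq : (signVector ℓ R s(i, j) : ℤ) * rightDiff R i j (lca ℓ s(i, j)) = 1 := by
      rw [lca_mk, h.rightDiff_inf hlt.ne]
      simp [signVector, hlt.ne, hlt.le, ← Units.val_mul]
    rw [hsq]
    simp [X, monomial_mul]
  · intro v _ hv
    by_cases hle : δ v ≤ δ (lca ℓ s(i, j))
    · rw [h.rightDiff_eq_zero hδ hv hle]
      simp
    · have : δ v - δ (lca ℓ s(i, j)) ≠ 0 := by omega
      simp only [lca_mk] at this
      simp [this]
  · simp

end Family

/-! ### Substitution at a value of `t`. -/

section Specialization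

theorem aeval_C_mul_X_monomial {σ B : Type*} [CommRing B] [Algebra ℂ B] (a : σ → B) (u : σ →₀ ℕ)
    (c : ℂ) : aeval (fun s => C (a s) * X s : σ → MvPolynomial σ B) (monomial u c) =
      monomial u (algebraMap ℂ B c * u.prod fun s k => a s ^ k) := by
  rw [aeval_monomial]
  simp_rw [mul_pow, ← C_pow]
  rw [Finsupp.prod_mul, ← map_finsuppProd, Finsupp.prod, Finsupp.prod, prod_X_pow_eq_monomial,
    ← mul_assoc, IsScalarTower.algebraMap_apply ℂ B (MvPolynomial σ B), algebraMap_eq, ← C_mul, C_mul_monomial,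
    mul_one]

theorem map_aeval_eq_aeval_map {σ κ B : Type*} [CommRing B] [Algebra ℂ B] (c : ℂ)
    (Θ : MvPolynomial κ (Polynomial ℂ) →+* B)
    (hΘ : ∀ p : Polynomial ℂ, Θ (C p) = algebraMap ℂ B (p.eval c))
    (q : σ → MvPolynomial κ (Polynomial ℂ)) (f : MvPolynomial σ (Polynomial ℂ)) :
    Θ (aeval q f) =
      aeval (fun s => Θ (q s)) (MvPolynomial.map (Polynomial.evalRingHom c) f) := by
  induction f using MvPolynomial.induction_on with
  | C p => simp [hΘ, algebraMap_eq]
  | add p q hp hq => simp only [map_add, hp, hq]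
  | mul_X p s hp => simp only [map_mul, hp, aeval_X, map_X]

end Specialization

/-! ### The ideal of the family and its fibres. -/

section FamilyIdeal

variable {V : Type*} [SemilatticeInf V] {n : ℕ}

/-- The rescaling of the coordinates in the fibre of the family over `c`. -/
def fiberScale (ℓ : Fin n → V) (R : V → Fin n → Prop) (δ : V → ℕ) {c : ℂ} (hc : c ≠ 0)
    (s : Sym2 (Fin n)) : ℂˣ :=
  Units.map (Int.castRingHom ℂ : ℤ →* ℂ) (signVector ℓ R s) * Units.mk0 c hc ^ δ (lca ℓ s)

theorem coe_fiberScale {ℓ : Fin n → V} {R : V → Fin n → Prop} {δ : V → ℕ} {c : ℂ} (hc : c ≠ 0)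
    (s : Sym2 (Fin n)) :
    (fiberScale ℓ R δ hc s : ℂ) = ((signVector ℓ R s : ℤ) : ℂ) * c ^ δ (lca ℓ s) := by
  simp [fiberScale]

variable [Fintype V]

/-- The ideal of the family: the kernel of its parametrization. -/
def familyIdeal (ℓ : Fin n → V) (R : V → Fin n → Prop) (δ : V → ℕ) :
    Ideal (MvPolynomial (Sym2 (Fin n)) (Polynomial ℂ)) :=
  RingHom.ker (aeval (familyCoord ℓ R δ) :
    MvPolynomial (Sym2 (Fin n)) (Polynomial ℂ) →ₐ[Polynomial ℂ]
      MvPolynomial (FamilyParam V n) (Polynomial ℂ))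

/-- The quotient embeds in a polynomial ring over `ℂ[t]`, so it is torsion-free, and torsion-free
modules over a principal ideal domain are flat. -/
theorem flat_quotient_familyIdeal (ℓ : Fin n → V) (R : V → Fin n → Prop) (δ : V → ℕ) :
    Module.Flat (Polynomial ℂ)
      (MvPolynomial (Sym2 (Fin n)) (Polynomial ℂ) ⧸ familyIdeal ℓ R δ) := by
  have hinj := Ideal.kerLiftAlg_injective (aeval (familyCoord ℓ R δ) :
    MvPolynomial (Sym2 (Fin n)) (Polynomial ℂ) →ₐ[Polynomial ℂ]
      MvPolynomial (FamilyParam V n) (Polynomial ℂ))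
  have : Module.IsTorsionFree (Polynomial ℂ)
      (MvPolynomial (Sym2 (Fin n)) (Polynomial ℂ) ⧸ familyIdeal ℓ R δ) :=
    hinj.moduleIsTorsionFree _ fun c x => map_smul _ c x
  infer_instance

theorem homogeneousComponent_mem_familyIdeal {ℓ : Fin n → V} {R : V → Fin n → Prop} {δ : V → ℕ}
    {f : MvPolynomial (Sym2 (Fin n)) (Polynomial ℂ)} (hf : f ∈ familyIdeal ℓ R δ) (d : ℕ) :
    homogeneousComponent d f ∈ familyIdeal ℓ R δ := by
  rw [familyIdeal, RingHom.mem_ker] at hf ⊢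
  have hhom : ∀ k, (aeval (familyCoord ℓ R δ) (homogeneousComponent k f)).IsHomogeneous (3 * k) :=
    fun k => (homogeneousComponent_isHomogeneous k f).aeval _ (isHomogeneous_familyCoord ℓ R δ)
  rcases lt_or_ge f.totalDegree d with hd | hd
  · rw [homogeneousComponent_eq_zero _ _ hd, map_zero]
  have h := congrArg (homogeneousComponent (3 * d)) hf
  rw [← sum_homogeneousComponent f, map_sum, map_sum, map_zero,
    Finset.sum_eq_single_of_mem d (Finset.mem_range.2 (Nat.lt_succ_of_le hd))] at h
  · rwa [homogeneousComponent_of_mem (hhom d), if_pos rfl] at h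
  · intro k _ hk
    rw [homogeneousComponent_of_mem (hhom k), if_neg (by omega)]

theorem mem_familyIdeal_of_pow_mul_mem {ℓ : Fin n → V} {R : V → Fin n → Prop} {δ : V → ℕ}
    {g : MvPolynomial (Sym2 (Fin n)) (Polynomial ℂ)} (m : ℕ)
    (hg : C (Polynomial.X ^ m) * g ∈ familyIdeal ℓ R δ) : g ∈ familyIdeal ℓ R δ := by
  rw [familyIdeal, RingHom.mem_ker] at hg ⊢
  rw [map_mul, mul_eq_zero] at hg
  refine hg.resolve_left ?_
  simp

variable {ℓ : Fin n → V} {R : V → Fin n → Prop} {δ : V → ℕ}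

theorem IsPlanarTree.aeval_mem_familyIdeal (h : IsPlanarTree ℓ R) (hδ : StrictMono δ)
    {f : MvPolynomial (Sym2 (Fin n)) ℂ} (hf : f ∈ grassmannianIdeal n) :
    aeval (fun s => C (((signVector ℓ R s : ℤ) : Polynomial ℂ) *
      Polynomial.X ^ δ (lca ℓ s)) * X s) f ∈ familyIdeal ℓ R δ := by
  rw [familyIdeal, RingHom.mem_ker, ← AlgHom.restrictScalars_apply ℂ, ← AlgHom.comp_apply,
    comp_aeval]
  rw [← aeval_minor_eq_zero hf (fun i => X (Sum.inr (Sum.inl i)))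
    (fun i => X (Sum.inr (Sum.inl i)) * affineCoord R δ i)
    (fun i => C (Polynomial.X ^ δ (ℓ i)) * X (Sum.inr (Sum.inr i)) ^ 3 :
      Fin n → MvPolynomial (FamilyParam V n) (Polynomial ℂ))]
  congr 2
  ext1 s
  rw [AlgHom.restrictScalars_apply, map_mul, aeval_X, aeval_C, algebraMap_eq, C_mul, mul_assoc,
    h.pow_mul_familyCoord hδ s, map_intCast, ← mul_assoc, ← Int.cast_mul, ← Units.val_mul,
    Int.units_mul_self]
  simp

/-- The parametrization over `c ≠ 0` reaches every matrix without zeros in the first row, with any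
diagonal coordinates. -/
theorem IsPlanarTree.exists_point (h : IsPlanarTree ℓ R) (hδ : StrictMono δ) {c : ℂ} (hc : c ≠ 0)
    (u v w : Fin n → ℂ) (hu : ∀ i, u i ≠ 0) : ∃ θ : FamilyParam V n → ℂ, ∀ s,
      minor u v w s = fiberScale ℓ R δ hc s *
        eval₂Hom (Polynomial.evalRingHom c) θ (familyCoord ℓ R δ s) := by
  classical
  have hcube : ∀ i, ∃ z : ℂ, z ^ 3 = w i / c ^ δ (ℓ i) := fun i =>
    IsAlgClosed.exists_pow_nat_eq _ (by norm_num)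
  choose z hz using hcube
  have hinj : Function.Injective ℓ := fun i j hij => h.eq_of_le i j hij.le
  -- With `b` supported on the leaves, only the term of the leaf `i` itself contributes to `y_i`, so
  -- each `y_i` can be prescribed freely.
  let b : V → ℂ := Function.extend ℓ (fun i => v i / u i / c ^ δ (ℓ i)) 0
  refine ⟨Sum.elim b (Sum.elim u z), fun s => ?_⟩
  set Θ := eval₂Hom (Polynomial.evalRingHom c) (Sum.elim b (Sum.elim u z)) with hΘ
  have hy : ∀ i, Θ (affineCoord R δ i) = v i / u i := by
    intro i
    rw [affineCoord, map_sum, Finset.sum_eq_single (ℓ i)]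
    · have : b (ℓ i) = v i / u i / c ^ δ (ℓ i) := hinj.extend_apply _ _ i
      simp [hΘ, h.right_self, this]
      field_simp
    · intro x _ hx
      by_cases hR : R x i
      · have : b x = 0 := by
          refine Function.extend_apply' _ _ _ ?_
          rintro ⟨k, rfl⟩
          exact hx (congrArg ℓ (h.eq_of_le k i (h.le_of_right _ _ hR)))
        simp [hΘ, this]
      · simp [hR]
    · simp
  have key := congrArg Θ (h.pow_mul_familyCoord hδ s)
  rw [map_mul, map_mul, map_minor, map_intCast] at key
  have h₁ : (fun i => Θ (X (Sum.inr (Sum.inl i)))) = u := by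
    ext i
    simp [hΘ]
  have h₂ : (fun i => Θ (X (Sum.inr (Sum.inl i)) * affineCoord R δ i)) = v := by
    ext i
    rw [map_mul, hy]
    simp [hΘ]
    field_simp [hu i]
  have h₃ : (fun i => Θ (C (Polynomial.X ^ δ (ℓ i)) * X (Sum.inr (Sum.inr i)) ^ 3)) = w := by
    ext i
    simp [hΘ, hz]
    field_simp
  rw [h₁, h₂, h₃] at key
  have h₄ : Θ (C (Polynomial.X ^ δ (lca ℓ s))) = c ^ δ (lca ℓ s) := by
    simp [hΘ]
  rw [h₄] at key
  rw [coe_fiberScale, mul_assoc, key, ← mul_assoc, ← Int.cast_mul, ← Units.val_mul,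
    Int.units_mul_self]
  simp

theorem IsPlanarTree.fiberIdeal_familyIdeal (h : IsPlanarTree ℓ R) (hδ : StrictMono δ) {c : ℂ}
    (hc : c ≠ 0) :
    fiberIdeal (familyIdeal ℓ R δ) c = rescale (fiberScale ℓ R δ hc) (grassmannianIdeal n) := by
  apply le_antisymm
  · refine Ideal.map_le_iff_le_comap.2 fun f hf => ?_
    rw [Ideal.mem_comap]
    set fc := MvPolynomial.map (Polynomial.evalRingHom c) f with hfc
    have hmem : aeval (fun s => C ((fiberScale ℓ R δ hc s)⁻¹ : ℂ) * X s) fc ∈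
        grassmannianIdeal n := by
      refine mem_grassmannianIdeal_of_ne_zero fun u v w hu => ?_
      obtain ⟨θ, hθ⟩ := h.exists_point hδ hc u v w hu
      have hz := map_aeval_eq_aeval_map c (eval₂Hom (Polynomial.evalRingHom c) θ) (by simp)
        (familyCoord ℓ R δ) f
      rw [RingHom.mem_ker.1 hf, map_zero, ← hfc] at hz
      rw [← AlgHom.comp_apply, comp_aeval, hz]
      congr 2
      ext1 s
      rw [map_mul, aeval_X, hθ s, aeval_C, ← mul_assoc]
      simp
    have := Ideal.mem_map_of_mem
      (aeval fun s => C (fiberScale ℓ R δ hc s : ℂ) * X s : MvPolynomial (Sym2 (Fin n)) ℂ →ₐ[ℂ] _)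
      hmem
    rw [rescale]
    convert this
    rw [← AlgHom.comp_apply, comp_aeval]
    conv_lhs => rw [← aeval_X_left_apply fc]
    congr 2
    ext1 s
    rw [map_mul, aeval_X, aeval_C, algebraMap_eq, ← mul_assoc, ← C_mul]
    simp
  · refine Ideal.map_le_iff_le_comap.2 fun f hf => ?_
    rw [Ideal.mem_comap]
    have := Ideal.mem_map_of_mem (MvPolynomial.map (Polynomial.evalRingHom c))
      (h.aeval_mem_familyIdeal hδ hf)
    rw [fiberIdeal]
    convert this
    clear this hf
    induction f using MvPolynomial.induction_on with
    | C a => simp [algebraMap_eq]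
    | add p q hp hq => simp only [map_add, hp, hq]
    | mul_X p s hp =>
      rw [map_mul, map_mul, map_mul, hp, aeval_X, aeval_X, map_mul, map_C, map_X, coe_fiberScale]
      simp

theorem IsPlanarTree.fiberIdeal_zero_le (h : IsPlanarTree ℓ R) (hδ : StrictMono δ) :
    fiberIdeal (familyIdeal ℓ R δ) 0 ≤ RingHom.ker (monomialMap (specialExp ℓ)) := by
  refine Ideal.map_le_iff_le_comap.2 fun f hf => ?_
  rw [Ideal.mem_comap, RingHom.mem_ker]
  have hz := map_aeval_eq_aeval_map 0 (MvPolynomial.map (Polynomial.evalRingHom 0))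
    (by simp [algebraMap_eq]) (familyCoord ℓ R δ) f
  rw [RingHom.mem_ker.1 hf, map_zero] at hz
  simp_rw [h.map_familyCoord_zero hδ] at hz
  exact hz.symm

/-- Dividing the signed Plücker relation by the common power of `t` on its left leaves `t ^ e` with
`e > 0` in front of `σ_ab σ_cd`, which disappears at `t = 0`. -/
theorem IsPlanarTree.containsQuadrics_fiberIdeal_zero (h : IsPlanarTree ℓ R) (hδ : StrictMono δ) :
    ContainsQuadrics ℓ (fiberIdeal (familyIdeal ℓ R δ) 0) := by
  intro l a b c d ha hb hc hd
  rcases eq_or_ne a b with rfl | hab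
  · rw [mul_comm, sub_self]
    exact Ideal.zero_mem _
  rcases eq_or_ne c d with rfl | hcd
  · rw [sub_self]
    exact Ideal.zero_mem _
  have hlt := h.weight_lt hδ ha hb hc hd
  have heq := h.lca_add_eq δ ha hb hc hd
  obtain ⟨e, he⟩ := exists_add_of_le hlt.le
  have he0 : e ≠ 0 := by omega
  set g : MvPolynomial (Sym2 (Fin n)) (Polynomial ℂ) :=
    X s(a, c) * X s(b, d) - X s(a, d) * X s(b, c) -
      C ((pluckerSign ℓ R a b c d : Polynomial ℂ) * Polynomial.X ^ e) * (X s(a, b) * X s(c, d))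
    with hg
  have hgF : g ∈ familyIdeal ℓ R δ := by
    refine mem_familyIdeal_of_pow_mul_mem (δ (lca ℓ s(a, c)) + δ (lca ℓ s(b, d))) ?_
    have hp := h.signed_plucker ha hb hc hd hab hcd _ _ _
      (fun s => C (Polynomial.X ^ δ (lca ℓ s)) * familyCoord ℓ R δ s) (h.pow_mul_familyCoord hδ)
    rw [familyIdeal, RingHom.mem_ker, hg]
    simp only [map_mul, map_sub, aeval_X, aeval_C, algebraMap_eq, map_intCast]
    have e₁ : (C (Polynomial.X ^ (δ (lca ℓ s(a, c)) + δ (lca ℓ s(b, d)))) :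
        MvPolynomial (FamilyParam V n) (Polynomial ℂ)) =
        C (Polynomial.X ^ δ (lca ℓ s(a, c))) * C (Polynomial.X ^ δ (lca ℓ s(b, d))) := by
      rw [pow_add, C_mul]
    have e₂ : (C (Polynomial.X ^ (δ (lca ℓ s(a, c)) + δ (lca ℓ s(b, d)))) :
        MvPolynomial (FamilyParam V n) (Polynomial ℂ)) =
        C (Polynomial.X ^ δ (lca ℓ s(a, d))) * C (Polynomial.X ^ δ (lca ℓ s(b, c))) := by
      rw [← heq, pow_add, C_mul]
    have e₃ : (C (Polynomial.X ^ (δ (lca ℓ s(a, c)) + δ (lca ℓ s(b, d)))) :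
        MvPolynomial (FamilyParam V n) (Polynomial ℂ)) * C (Polynomial.X ^ e) =
        C (Polynomial.X ^ δ (lca ℓ s(a, b))) * C (Polynomial.X ^ δ (lca ℓ s(c, d))) := by
      rw [← C_mul, ← C_mul, ← pow_add, ← pow_add, he]
    linear_combination hp + familyCoord ℓ R δ s(a, c) * familyCoord ℓ R δ s(b, d) * e₁ -
      familyCoord ℓ R δ s(a, d) * familyCoord ℓ R δ s(b, c) * e₂ -
      (pluckerSign ℓ R a b c d : MvPolynomial (FamilyParam V n) (Polynomial ℂ)) *
        (familyCoord ℓ R δ s(a, b) * familyCoord ℓ R δ s(c, d)) * e₃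
  have := Ideal.mem_map_of_mem (MvPolynomial.map (Polynomial.evalRingHom 0)) hgF
  rw [fiberIdeal]
  convert this
  simp [hg, he0]

end FamilyIdeal

/-! ### Initial forms, and the initial ideal between the quadrics and the special fibre. -/

section InitialForm

variable {σ : Type*}

theorem initialForm_add {ω : σ → ℝ} {f g : MvPolynomial σ ℂ} {a b : ℝ}
    (hf : IsWeightedHomogeneous ω f a) (hg : IsWeightedHomogeneous ω g b) (hba : b < a)
    (hf0 : f ≠ 0) : initialForm ω (f + g) = f := by
  classical
  have hgf : ∀ u ∈ f.support, coeff u g = 0 := by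
    intro u hu
    by_contra hne
    exact hba.ne ((hg hne).symm.trans (hf (mem_support_iff.1 hu)))
  have hsub : ∀ u ∈ f.support, u ∈ (f + g).support := by
    intro u hu
    rw [mem_support_iff, coeff_add, hgf u hu, add_zero]
    exact mem_support_iff.1 hu
  obtain ⟨u₀, hu₀⟩ := Finset.nonempty_iff_ne_empty.2 (mt support_eq_empty.1 hf0)
  have hfilter : {u ∈ (f + g).support | ∀ v ∈ (f + g).support,
      Finsupp.weight ω v ≤ Finsupp.weight ω u} = f.support := by
    ext u
    rw [Finset.mem_filter]
    constructor
    · rintro ⟨hu, hmax⟩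
      by_contra hnot
      rw [notMem_support_iff] at hnot
      rw [mem_support_iff, coeff_add, hnot, zero_add] at hu
      have := hmax u₀ (hsub u₀ hu₀)
      rw [hg hu, hf (mem_support_iff.1 hu₀)] at this
      exact hba.not_ge this
    · refine fun hu => ⟨hsub u hu, fun v hv => ?_⟩
      rw [hf (mem_support_iff.1 hu)]
      by_cases hv' : coeff v f = 0
      · rw [mem_support_iff, coeff_add, hv', zero_add] at hv
        rw [hg hv]
        exact hba.le
      · rw [hf hv']
  unfold initialForm
  conv_rhs => rw [f.as_sum]
  refine Finset.sum_congr ?_ fun u hu => ?_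
  · convert hfilter
  · rw [coeff_add, hgf u hu, add_zero]

end InitialForm

section InitialIdeal

variable {V : Type*} [SemilatticeInf V] {n : ℕ}

/-- The weight vector of a tree. -/
def treeWeight (ℓ : Fin n → V) (δ : V → ℕ) (s : Sym2 (Fin n)) : ℝ := -(δ (lca ℓ s) : ℝ)

variable {ℓ : Fin n → V} {R : V → Fin n → Prop} {δ : V → ℕ}

theorem weight_treeWeight (u : Sym2 (Fin n) →₀ ℕ) :
    Finsupp.weight (treeWeight ℓ δ) u = -(Finsupp.weight (fun s => δ (lca ℓ s)) u : ℝ) := by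
  simp [Finsupp.weight_apply, Finsupp.sum, treeWeight]

theorem IsPlanarTree.containsQuadrics_signAct_initialIdeal (h : IsPlanarTree ℓ R)
    (hδ : StrictMono δ) : ContainsQuadrics ℓ (signAct (signVector ℓ R)
      (initialIdeal (treeWeight ℓ δ) (grassmannianIdeal n))) := by
  intro l a b c d ha hb hc hd
  rcases eq_or_ne a b with rfl | hab
  · rw [mul_comm, sub_self]
    exact Ideal.zero_mem _
  rcases eq_or_ne c d with rfl | hcd
  · rw [sub_self]
    exact Ideal.zero_mem _
  have hlt := h.weight_lt hδ ha hb hc hd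
  let τ : Sym2 (Fin n) → ℂ := fun s => ((signVector ℓ R s : ℤ) : ℂ)
  have hτ : ∀ s, τ s * τ s = 1 := by
    intro s
    simp only [τ]
    rw [← Int.cast_mul, ← Units.val_mul, Int.units_mul_self]
    simp
  set f : MvPolynomial (Sym2 (Fin n)) ℂ := C (τ s(a, c) * τ s(b, d)) * (X s(a, c) * X s(b, d)) -
    C (τ s(a, d) * τ s(b, c)) * (X s(a, d) * X s(b, c)) with hf
  set g : MvPolynomial (Sym2 (Fin n)) ℂ :=
    C (-(pluckerSign ℓ R a b c d * (τ s(a, b) * τ s(c, d)))) * (X s(a, b) * X s(c, d)) with hg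
  have hmem : f + g ∈ grassmannianIdeal n := by
    refine mem_grassmannianIdeal_iff.2 fun u v w => ?_
    have hp := h.signed_plucker ha hb hc hd hab hcd u v w
      (fun s => τ s * minor u v w s) fun _ => rfl
    simp only [hf, hg, map_add, map_sub, map_mul, aeval_X, aeval_C, Algebra.algebraMap_self,
      RingHom.id_apply, map_neg]
    linear_combination hp
  have himage : (aeval (fun s => C (τ s) * X s) f : MvPolynomial (Sym2 (Fin n)) ℂ) =
      X s(a, c) * X s(b, d) - X s(a, d) * X s(b, c) := by
    have hC : ∀ s, (C (τ s) * C (τ s) : MvPolynomial (Sym2 (Fin n)) ℂ) = 1 := by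
      intro s
      rw [← C_mul, hτ, C_1]
    simp only [hf, map_sub, map_mul, aeval_X, aeval_C, algebraMap_eq]
    linear_combination (X s(a, c) * X s(b, d) * C (τ s(b, d)) * C (τ s(b, d))) * hC s(a, c) +
      X s(a, c) * X s(b, d) * hC s(b, d) -
      (X s(a, d) * X s(b, c) * C (τ s(b, c)) * C (τ s(b, c))) * hC s(a, d) -
      X s(a, d) * X s(b, c) * hC s(b, c)
  rw [← himage]
  refine Ideal.mem_map_of_mem _ ?_
  rcases eq_or_ne f 0 with hf0 | hf0
  · rw [hf0]
    exact Ideal.zero_mem _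
  have hX : ∀ s, IsWeightedHomogeneous (treeWeight ℓ δ) (X s : MvPolynomial (Sym2 (Fin n)) ℂ)
      (treeWeight ℓ δ s) := fun s => isWeightedHomogeneous_X _ _ _
  have hq : ∀ (x : ℂ) (s t : Sym2 (Fin n)), IsWeightedHomogeneous (treeWeight ℓ δ)
      (C x * (X s * X t)) (treeWeight ℓ δ s + treeWeight ℓ δ t) := by
    intro x s t
    simpa using (isWeightedHomogeneous_C (treeWeight ℓ δ) x).mul ((hX s).mul (hX t))
  have hfw : IsWeightedHomogeneous (treeWeight ℓ δ) f
      (treeWeight ℓ δ s(a, c) + treeWeight ℓ δ s(b, d)) := by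
    refine Submodule.sub_mem (weightedHomogeneousSubmodule ℂ (treeWeight ℓ δ) _) (hq _ _ _) ?_
    have := hq (τ s(a, d) * τ s(b, c)) s(a, d) s(b, c)
    rwa [show treeWeight ℓ δ s(a, d) + treeWeight ℓ δ s(b, c) =
      treeWeight ℓ δ s(a, c) + treeWeight ℓ δ s(b, d) from
        h.lca_add_eq (fun v => -(δ v : ℝ)) ha hb hc hd] at this
  have hwlt : treeWeight ℓ δ s(a, b) + treeWeight ℓ δ s(c, d) <
      treeWeight ℓ δ s(a, c) + treeWeight ℓ δ s(b, d) := by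
    have : ((δ (lca ℓ s(a, c)) + δ (lca ℓ s(b, d)) : ℕ) : ℝ) <
      ((δ (lca ℓ s(a, b)) + δ (lca ℓ s(c, d)) : ℕ) : ℝ) := Nat.cast_lt.2 hlt
    push_cast at this
    unfold treeWeight
    linarith
  have hin := initialForm_add (g := g) hfw (hq _ _ _) hwlt hf0
  exact Ideal.subset_span ⟨f + g, hmem, hin⟩

theorem IsPlanarTree.signAct_initialIdeal_le [Fintype V] (h : IsPlanarTree ℓ R)
    (hδ : StrictMono δ) : signAct (signVector ℓ R)
      (initialIdeal (treeWeight ℓ δ) (grassmannianIdeal n)) ≤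
        fiberIdeal (familyIdeal ℓ R δ) 0 := by
  classical
  rw [signAct, rescale, Ideal.map_le_iff_le_comap, initialIdeal, Ideal.span_le]
  rintro _ ⟨f, hf, rfl⟩
  rw [SetLike.mem_coe, Ideal.mem_comap]
  rcases eq_or_ne f 0 with rfl | hf0
  · simp [initialForm]
  set wt : (Sym2 (Fin n) →₀ ℕ) → ℕ := fun u => Finsupp.weight (fun s => δ (lca ℓ s)) u with hwt
  obtain ⟨u₀, hu₀, hmin⟩ := Finset.exists_min_image f.support wt
    (Finset.nonempty_iff_ne_empty.2 (mt support_eq_empty.1 hf0))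
  let T : (Sym2 (Fin n) →₀ ℕ) → ℂ := fun u => u.prod fun s k => ((signVector ℓ R s : ℤ) : ℂ) ^ k
  -- `g` is `f` after `σ_s ↦ τ_s t^δ(lca s) σ_s`, divided by the least power of `t` that occurs.
  -- Least `wt` is maximal `ω`-weight, so setting `t = 0` leaves the signed initial form.
  set g : MvPolynomial (Sym2 (Fin n)) (Polynomial ℂ) := ∑ u ∈ f.support,
    monomial u (Polynomial.C (coeff u f * T u) * Polynomial.X ^ (wt u - wt u₀)) with hg
  have hgF : g ∈ familyIdeal ℓ R δ := by
    refine mem_familyIdeal_of_pow_mul_mem (wt u₀) ?_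
    convert h.aeval_mem_familyIdeal hδ hf
    conv_rhs => rw [f.as_sum]
    rw [hg, Finset.mul_sum, map_sum]
    refine Finset.sum_congr rfl fun u hu => ?_
    rw [aeval_C_mul_X_monomial, C_mul_monomial]
    congr 1
    have hle := hmin u hu
    have hprod : (u.prod fun s k => (((signVector ℓ R s : ℤ) : Polynomial ℂ) *
        Polynomial.X ^ δ (lca ℓ s)) ^ k) = Polynomial.C (T u) * Polynomial.X ^ wt u := by
      simp only [mul_pow, Finsupp.prod_mul, T, hwt, map_finsuppProd, map_pow, map_intCast]
      congr 1
      rw [Finsupp.weight_apply, Finsupp.sum, ← Finset.prod_pow_eq_pow_sum, Finsupp.prod]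
      refine Finset.prod_congr rfl fun s _ => ?_
      rw [← pow_mul, smul_eq_mul, mul_comm]
    rw [hprod, Polynomial.C_mul, ← Polynomial.algebraMap_eq]
    conv_rhs => rw [← Nat.add_sub_cancel' hle, pow_add]
    ring
  have := Ideal.mem_map_of_mem (MvPolynomial.map (Polynomial.evalRingHom 0)) hgF
  rw [fiberIdeal]
  convert this
  rw [initialForm, map_sum, Finset.sum_filter, hg, map_sum]
  refine Finset.sum_congr rfl fun u hu => ?_
  rw [map_monomial]
  have hiff : (∀ v ∈ f.support, Finsupp.weight (treeWeight ℓ δ) v ≤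
      Finsupp.weight (treeWeight ℓ δ) u) ↔ wt u - wt u₀ = 0 := by
    simp only [weight_treeWeight, neg_le_neg_iff, Nat.cast_le]
    constructor
    · intro hu'
      exact Nat.sub_eq_zero_of_le (hu' u₀ hu₀)
    · intro hu' v hv
      exact (Nat.le_of_sub_eq_zero hu').trans (hmin v hv)
  by_cases hu' : wt u - wt u₀ = 0
  · rw [if_pos (hiff.2 hu'), aeval_C_mul_X_monomial, hu', pow_zero, mul_one,
      Polynomial.coe_evalRingHom, Polynomial.eval_C]
    rfl
  · rw [if_neg (mt hiff.1 hu')]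
    simp [hu']

end InitialIdeal

/-! ### From monomial maps to Laurent monomials. -/

section Toric

theorem isToricIdeal_ker_monomialMap {σ κ : Type*} [Finite κ] (A : σ → κ →₀ ℕ) :
    IsToricIdeal (RingHom.ker (monomialMap A)) := by
  obtain ⟨m, ⟨e⟩⟩ := Finite.exists_equiv_fin κ
  let φ : (κ →₀ ℕ) →+ (Fin m → ℤ) :=
    { toFun := fun u k => (u (e.symm k) : ℤ)
      map_zero' := by ext; simp
      map_add' := fun u v => by ext; simp }
  have hφ : Function.Injective φ := by
    intro u v huv
    ext k
    have := congrFun huv (e k)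
    simpa [φ] using this
  refine ⟨m, fun s => φ (A s), ?_⟩
  have hcomp : (aeval fun s => AddMonoidAlgebra.single (φ (A s)) 1 :
      MvPolynomial σ ℂ →ₐ[ℂ] AddMonoidAlgebra ℂ (Fin m → ℤ)) =
      (AddMonoidAlgebra.mapDomainAlgHom ℂ ℂ φ).comp (monomialMap A) := by
    refine MvPolynomial.algHom_ext fun s => ?_
    rw [aeval_X, AlgHom.comp_apply, monomialMap, aeval_X]
    exact (AddMonoidAlgebra.mapDomain_single).symm
  ext f
  rw [RingHom.mem_ker, RingHom.mem_ker, hcomp, AlgHom.comp_apply]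
  refine ⟨fun hf => by rw [hf, map_zero], fun hf => ?_⟩
  exact AddMonoidAlgebra.mapDomain_injective hφ (hf.trans (AddMonoidAlgebra.mapDomain_zero φ).symm)

end Toric

/-! ### Reading the shape off the exponent. -/

section Shape

variable {σ κ : Type*}

open Classical in
theorem expMap_apply_eq_mul_tally {A : σ → κ →₀ ℕ} {p : σ → Prop} {x : κ} {k : ℕ}
    (hA : ∀ s, A s x = if p s then k else 0) (u : σ →₀ ℕ) : expMap A u x = k * tally p u := by
  rw [expMap, tally, Finsupp.weight_apply, Finsupp.weight_apply, Finsupp.sum, Finsupp.sum,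
    Finsupp.finsetSum_apply, Finset.mul_sum]
  refine Finset.sum_congr rfl fun s _ => ?_
  rw [Finsupp.smul_apply, hA]
  split_ifs <;> simp [mul_comm]

theorem tally_eq_of_expMap_eq {A : σ → κ →₀ ℕ} {p : σ → Prop} {x : κ} {k : ℕ} (hk : 0 < k)
    (hA : ∀ s, (p s → A s x = k) ∧ (¬ p s → A s x = 0)) {u u' : σ →₀ ℕ}
    (huu : expMap A u = expMap A u') : tally p u = tally p u' := by
  classical
  have hA' : ∀ s, A s x = if p s then k else 0 := by
    intro s
    split_ifs with hp
    exacts [(hA s).1 hp, (hA s).2 hp]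
  have := congrArg (· x) huu
  simp only [expMap_apply_eq_mul_tally hA'] at this
  exact Nat.eq_of_mul_eq_mul_left hk this

variable {V : Type*} [SemilatticeInf V] {n : ℕ} {ℓ : Fin n → V} {R : V → Fin n → Prop}

/-- The exponent of `b_v` counts the factors with common ancestor `v` when `v` is not in the range
of `ℓ`. At a leaf only the diagonal factor counts, read from `z_k` with multiplicity `3`; `x_k`
gives the off-diagonal degree. -/
theorem IsPlanarTree.sameShape_of_specialExp (h : IsPlanarTree ℓ R) {u u' : Sym2 (Fin n) →₀ ℕ}
    (huu : expMap (specialExp ℓ) u = expMap (specialExp ℓ) u') : SameShape ℓ u u' := by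
  classical
  have hexp : ∀ i j, i ≤ j → specialExp ℓ s(i, j) =
      if i = j then Finsupp.single (Sum.inr (Sum.inr i)) 3 else
        Finsupp.single (Sum.inr (Sum.inl i)) 1 + Finsupp.single (Sum.inr (Sum.inl j)) 1 +
          Finsupp.single (Sum.inl (ℓ i ⊓ ℓ j)) 1 := by
    intro i j hij
    simp [specialExp, hij]
  have hind : ∀ P : Sym2 (Fin n) → Prop, (∀ i j, i ≤ j → P s(i, j)) → ∀ s, P s := by
    intro P hP s
    induction s with
    | _ i j =>
    rcases le_total i j with hij | hij
    · exact hP i j hij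
    · rw [Sym2.eq_swap]
      exact hP j i hij
  refine ⟨fun v => ?_, fun k => ?_⟩
  · by_cases hv : ∃ k, ℓ k = v
    · obtain ⟨k, rfl⟩ := hv
      refine tally_eq_of_expMap_eq (x := Sum.inr (Sum.inr k)) (k := 3) (by norm_num) ?_ huu
      refine hind _ fun i j hij => ?_
      rw [hexp i j hij]
      constructor
      · intro hs
        have := h.lca_eq_leaf hs
        obtain ⟨rfl, rfl⟩ : i = k ∧ j = k := by simpa using this
        simp
      · intro hs
        split_ifs with hij'
        · subst hij'
          rw [lca_mk, inf_idem] at hs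
          have : i ≠ k := fun e => hs (e ▸ rfl)
          simp [this]
        · simp
    · refine tally_eq_of_expMap_eq (x := Sum.inl v) (k := 1) (by norm_num) ?_ huu
      refine hind _ fun i j hij => ?_
      rw [hexp i j hij]
      split_ifs with hij'
      · subst hij'
        rw [lca_mk, inf_idem]
        exact ⟨fun hs => absurd ⟨i, hs⟩ hv, fun _ => by simp⟩
      · constructor <;> intro hs <;> rw [lca_mk] at hs <;> simp [hs]
  · refine tally_eq_of_expMap_eq (x := Sum.inr (Sum.inl k)) (k := 1) (by norm_num) ?_ huu
    refine hind _ fun i j hij => ?_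
    rw [hexp i j hij]
    split_ifs with hij'
    · simp [hij']
    · have : i = k → j = k → False := fun h₁ h₂ => hij' (h₁.trans h₂.symm)
      simp only [Sym2.mem_iff, Sym2.mk_isDiag_iff, hij', not_false_eq_true, and_true,
        Finsupp.add_apply, Finsupp.single_apply, Sum.inr.injEq, Sum.inl.injEq, reduceCtorEq,
        if_false]
      grind

end Shape

/-! ### The toric ideal of the network and the planar structure. -/

section Network

variable {V : Type*} [SemilatticeInf V] {T : Digraph V} {n : ℕ}

open Relation

/-- The edge `e` separates the leaves of the pair `s`. -/
def Separates (ℓ : Fin n → V) (e : Edge T) (s : Sym2 (Fin n)) : Prop :=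
  (∃ i ∈ s, e.1.2 ≤ ℓ i) ∧ ∃ i ∈ s, ¬ e.1.2 ≤ ℓ i

theorem separates_mk {ℓ : Fin n → V} {e : Edge T} {i j : Fin n} :
    Separates ℓ e s(i, j) ↔ Xor (e.1.2 ≤ ℓ i) (e.1.2 ≤ ℓ j) := by
  simp only [Separates, Sym2.mem_iff, exists_eq_or_imp, exists_eq_left, Xor]
  tauto

open Classical in
/-- The exponent of the monomial of the trek between the leaves of the pair `s`. -/
def networkExp (T : Digraph V) [Fintype (Edge T)] (ℓ : Fin n → V) (s : Sym2 (Fin n)) :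
    Param T →₀ ℕ :=
  Finsupp.single (Sum.inl (lca ℓ s)) 1 +
    ∑ e : Edge T, if Separates ℓ e s then Finsupp.single (Sum.inr e) 1 else 0

variable {ℓ : Fin n → V}

theorem IsRootedBinaryTree.exists_isPlanarTree (hT : IsRootedBinaryTree T)
    (hle : ∀ a b : V, a ≤ b ↔ ReflTransGen T.Adj a b) (hinj : Function.Injective ℓ)
    (hleaf : ∀ i, IsLeaf T (ℓ i)) : ∃ R, IsPlanarTree ℓ R := by
  classical
  have hex : ∀ v, ∃ c, (∃ w, T.Adj v w) → T.Adj v c := by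
    intro v
    by_cases hv : ∃ w, T.Adj v w
    · exact ⟨hv.choose, fun h => h.choose_spec⟩
    · exact ⟨v, fun h => absurd h hv⟩
  choose rc hrc using hex
  have heq : ∀ i j, ℓ i ≤ ℓ j → i = j := by
    intro i j hij
    rcases hij.eq_or_lt with h | h
    · exact hinj h
    · obtain ⟨c, hc, -⟩ := exists_child_of_lt hle h
      exact absurd hc (hleaf i c)
  -- Right of an inner vertex means below its chosen child `rc v`. The first disjunct puts each leaf
  -- to the right of itself, so that `y_i` contains a parameter of its own.
  refine ⟨fun v i => v = ℓ i ∨ T.Adj v (rc v) ∧ rc v ≤ ℓ i,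
    fun a b c => hT.le_total_of_le hle, heq, fun i => Or.inl rfl, ?_, ?_, ?_⟩
  · rintro v i (rfl | ⟨hv, hi⟩)
    · exact le_rfl
    · exact (hT.lt_of_adj hle hv).le.trans hi
  · rintro v x i j hvx hxi hxj (rfl | ⟨hv, hi⟩)
    · exact absurd hxi hvx.not_ge
    · refine Or.inr ⟨hv, ?_⟩
      rcases hT.le_total_of_le hle hi hxi with h | h
      · exact h.trans hxj
      · rcases h.eq_or_lt with h' | h'
        · exact h' ▸ hxj
        · exact absurd (hT.le_parent hle hv h') hvx.not_ge
  · intro i j hij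
    have hi : ℓ i ⊓ ℓ j < ℓ i :=
      lt_of_le_of_ne inf_le_left fun e => hij (heq i j (e ▸ inf_le_right))
    have hj : ℓ i ⊓ ℓ j < ℓ j :=
      lt_of_le_of_ne inf_le_right fun e => hij (heq j i (e ▸ inf_le_left)).symm
    obtain ⟨c, hc, hci⟩ := exists_child_of_lt hle hi
    obtain ⟨c', hc', hcj⟩ := exists_child_of_lt hle hj
    have hcut : ∀ x, T.Adj (ℓ i ⊓ ℓ j) x → x ≤ ℓ i → ¬ x ≤ ℓ j := fun x hx hxi hxj =>
      (hT.lt_of_adj hle hx).not_ge (le_inf hxi hxj)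
    have hcc : c ≠ c' := fun e => hcut c hc hci (e ▸ hcj)
    have hr := hrc _ ⟨c, hc⟩
    obtain ⟨x, y, -, hxy⟩ := Set.ncard_eq_two.1 (hT.binary (ℓ i ⊓ ℓ j) fun hl => hl c hc)
    have hmem : ∀ z, T.Adj (ℓ i ⊓ ℓ j) z → z = x ∨ z = y := fun z hz => by
      have : z ∈ {w | T.Adj (ℓ i ⊓ ℓ j) w} := hz
      rwa [hxy] at this
    -- Here binarity is essential: the chosen child must lead to exactly one of the two leaves.
    have hrcc : rc (ℓ i ⊓ ℓ j) = c ∨ rc (ℓ i ⊓ ℓ j) = c' := by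
      have h₁ := hmem _ hc
      have h₂ := hmem _ hc'
      have h₃ := hmem _ hr
      grind
    simp only [hi.ne, hj.ne, hr, false_or, true_and]
    rcases hrcc with e | e <;> rw [e]
    · exact ⟨fun _ => hcut c hc hci, fun _ => hci⟩
    · exact ⟨fun h => absurd hcj (hcut c' hc' h), fun h => absurd hcj h⟩

variable [Fintype (Edge T)]

open Classical in
theorem networkExp_inl (s : Sym2 (Fin n)) (v : V) :
    networkExp T ℓ s (Sum.inl v) = if lca ℓ s = v then 1 else 0 := by
  rw [networkExp, Finsupp.add_apply, Finsupp.finsetSum_apply, Finset.sum_eq_zero, add_zero,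
    Finsupp.single_apply]
  · simp
  · intro e _
    split_ifs <;> simp

open Classical in
theorem networkExp_inr (s : Sym2 (Fin n)) (e : Edge T) :
    networkExp T ℓ s (Sum.inr e) = if Separates ℓ e s then 1 else 0 := by
  rw [networkExp, Finsupp.add_apply, Finsupp.finsetSum_apply, Finset.sum_eq_single e,
    Finsupp.single_apply]
  · split_ifs <;> simp_all
  · intro e' _ he'
    split_ifs <;> simp [he']
  · simp

theorem observedIdeal_eq_ker [Finite V] (hT : IsRootedBinaryTree T)
    (hle : ∀ a b : V, a ≤ b ↔ ReflTransGen T.Adj a b) :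
    observedIdeal T ℓ = RingHom.ker (monomialMap (networkExp T ℓ)) := by
  classical
  have hcomp : (trekHom T).comp (rename (Sym2.map ℓ)) = monomialMap (networkExp T ℓ) := by
    refine MvPolynomial.algHom_ext fun s => ?_
    rw [AlgHom.comp_apply, rename_X, trekHom, aeval_X, monomialMap, aeval_X]
    induction s with
    | _ i j =>
    rw [Sym2.map_mk, Sym2.lift_mk]
    change trekSum T (ℓ i) (ℓ j) = _
    rw [trekSum_eq hT hle, networkExp, ← one_mul (1 : ℂ), ← monomial_mul, monomial_sum_one]
    refine congrArg₂ _ rfl (Finset.prod_congr rfl fun e _ => ?_)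
    by_cases hs : Separates ℓ e s(i, j)
    · rw [if_pos hs, if_pos (separates_mk.1 hs)]
      rfl
    · rw [if_neg hs, if_neg (mt separates_mk.2 hs)]
      rfl
  ext f
  rw [observedIdeal, networkIdeal, Ideal.mem_comap, RingHom.mem_ker, RingHom.mem_ker, ← hcomp]
  rfl

variable {R : V → Fin n → Prop}

/-- Whether an edge lies above both leaves of a pair depends only on their common ancestor, which
does not change when `a` and `b` are exchanged. So both products have the same multiset of tops and
of crossed edges. -/
theorem IsPlanarTree.containsQuadrics_network (h : IsPlanarTree ℓ R) :
    ContainsQuadrics ℓ (RingHom.ker (monomialMap (networkExp T ℓ))) := by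
  classical
  intro l a b c d ha hb hc hd
  have key : networkExp T ℓ s(a, c) + networkExp T ℓ s(b, d) =
      networkExp T ℓ s(a, d) + networkExp T ℓ s(b, c) := by
    have hac := h.inf_eq_inf ha hb hc
    have had := h.inf_eq_inf ha hb hd
    ext x
    rw [Finsupp.add_apply, Finsupp.add_apply]
    rcases x with v | e
    · have e₁ : lca ℓ s(a, c) = lca ℓ s(b, c) := hac
      have e₂ : lca ℓ s(a, d) = lca ℓ s(b, d) := had
      rw [networkExp_inl, networkExp_inl, networkExp_inl, networkExp_inl, e₁, e₂, add_comm]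
    · have e₁ : e.1.2 ≤ ℓ a ∧ e.1.2 ≤ ℓ c ↔ e.1.2 ≤ ℓ b ∧ e.1.2 ≤ ℓ c := by
        rw [← le_inf_iff, ← le_inf_iff, hac]
      have e₂ : e.1.2 ≤ ℓ a ∧ e.1.2 ≤ ℓ d ↔ e.1.2 ≤ ℓ b ∧ e.1.2 ≤ ℓ d := by
        rw [← le_inf_iff, ← le_inf_iff, had]
      simp only [networkExp_inr, separates_mk, Xor]
      by_cases h₁ : e.1.2 ≤ ℓ a <;> by_cases h₂ : e.1.2 ≤ ℓ b <;> by_cases h₃ : e.1.2 ≤ ℓ c <;>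
        by_cases h₄ : e.1.2 ≤ ℓ d <;> simp_all
  rw [RingHom.mem_ker, map_sub, map_mul, map_mul]
  simp only [monomialMap, aeval_X, monomial_mul, key, sub_self]

theorem IsPlanarTree.sameShape_of_networkExp (h : IsPlanarTree ℓ R) (hT : IsRootedBinaryTree T)
    (hle : ∀ a b : V, a ≤ b ↔ ReflTransGen T.Adj a b) {u u' : Sym2 (Fin n) →₀ ℕ}
    (huu : expMap (networkExp T ℓ) u = expMap (networkExp T ℓ) u') : SameShape ℓ u u' := by
  classical
  refine ⟨fun v => ?_, fun k => ?_⟩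
  · refine tally_eq_of_expMap_eq (x := Sum.inl v) (k := 1) one_pos (fun s => ?_) huu
    rw [networkExp_inl]
    exact ⟨fun hs => if_pos hs, fun hs => if_neg hs⟩
  -- With another leaf present, `ℓ k` is not the root, and the edge into it is crossed exactly by
  -- the off-diagonal pairs at `k`. With a single leaf there are no such pairs.
  · by_cases hk : ∃ j, j ≠ k
    · obtain ⟨j, hj⟩ := hk
      obtain ⟨p, hp⟩ := exists_parent_of_not_le hle hT (fun hkj => hj (h.eq_of_le k j hkj).symm)
      refine tally_eq_of_expMap_eq (x := Sum.inr ⟨(p, ℓ k), hp⟩) (k := 1) one_pos (fun s => ?_) huu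
      rw [networkExp_inr]
      have hiff : Separates ℓ (⟨(p, ℓ k), hp⟩ : Edge T) s ↔ k ∈ s ∧ ¬ s.IsDiag := by
        have hk : ∀ i, ℓ k ≤ ℓ i ↔ k = i := fun i => ⟨h.eq_of_le k i, fun e => e ▸ le_rfl⟩
        induction s with
        | _ a b =>
        rw [separates_mk]
        simp only [hk, Xor, Sym2.mem_iff, Sym2.mk_isDiag_iff]
        grind
      rw [← hiff]
      exact ⟨fun hs => if_pos hs, fun hs => if_neg hs⟩
    · push Not at hk
      have hzero : ∀ u : Sym2 (Fin n) →₀ ℕ, tally (fun s => k ∈ s ∧ ¬ s.IsDiag) u = 0 := by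
        intro u
        by_contra hne
        obtain ⟨s, ⟨-, hs⟩, -⟩ := exists_of_tally_ne_zero hne
        induction s with
        | _ a b => exact hs ((hk a).trans (hk b).symm)
      rw [hzero, hzero]

end Network

/-- The choice of `δ`: the number of ancestors of a vertex, itself included. -/
theorem strictMono_ncard_Iic {V : Type*} [PartialOrder V] [Finite V] :
    StrictMono fun v : V => (Set.Iic v).ncard := fun _ _ h =>
  Set.ncard_lt_ncard (Set.Iic_ssubset_Iic.2 h) (Set.toFinite _)

end HiddenTree

end

theorem mainTheorem6 {V : Type*} [Finite V] (T : Digraph V)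
    (hT : HiddenTree.IsRootedBinaryTree T)
    (n : ℕ) (leaf : Fin n ≃ {v : V // HiddenTree.IsLeaf T v}) :
    (∃ (ω : Sym2 (Fin n) → ℝ) (τ : Sym2 (Fin n) → ℤˣ),
      HiddenTree.observedIdeal T (fun i => (leaf i : V)) =
        HiddenTree.signAct τ
          (HiddenTree.initialIdeal ω (HiddenTree.grassmannianIdeal n))) ∧
    HiddenTree.IsToricDegeneration (HiddenTree.grassmannianIdeal n)
      (HiddenTree.observedIdeal T (fun i => (leaf i : V))) := by
  classical
  let _ := hT.semilatticeInf
  have hle : ∀ a b : V, a ≤ b ↔ Relation.ReflTransGen T.Adj a b := fun _ _ => Iff.rfl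
  have := Fintype.ofFinite V
  have := Fintype.ofFinite (HiddenTree.Edge T)
  set ℓ : Fin n → V := fun i => (leaf i : V)
  obtain ⟨R, h⟩ := hT.exists_isPlanarTree hle (ℓ := ℓ)
    (Subtype.val_injective.comp leaf.injective) fun i => (leaf i).2
  have hδ := HiddenTree.strictMono_ncard_Iic (V := V)
  rw [HiddenTree.observedIdeal_eq_ker hT hle]
  have hker : ∀ K, HiddenTree.ContainsQuadrics ℓ K →
      RingHom.ker (HiddenTree.monomialMap (HiddenTree.networkExp T ℓ)) ≤ K := fun K hK =>
    HiddenTree.ker_monomialMap_le _ fun u u' huu =>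
      h.monomial_sub_mem hK (h.sameShape_of_networkExp hT hle huu)
  have hfiber : HiddenTree.fiberIdeal (HiddenTree.familyIdeal ℓ R _) 0 =
      RingHom.ker (HiddenTree.monomialMap (HiddenTree.networkExp T ℓ)) :=
    le_antisymm ((h.fiberIdeal_zero_le hδ).trans (HiddenTree.ker_monomialMap_le _ fun u u' huu =>
        h.monomial_sub_mem h.containsQuadrics_network (h.sameShape_of_specialExp huu)))
      (hker _ (h.containsQuadrics_fiberIdeal_zero hδ))
  -- The placeholders for `ω` and `τ` are filled by `treeWeight` and `signVector`.
  refine ⟨⟨_, _, le_antisymm (hker _ (h.containsQuadrics_signAct_initialIdeal hδ))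
    ((h.signAct_initialIdeal_le hδ).trans hfiber.le)⟩,
    HiddenTree.isToricIdeal_ker_monomialMap _, HiddenTree.familyIdeal ℓ R _,
    fun f hf d => HiddenTree.homogeneousComponent_mem_familyIdeal hf d,
    HiddenTree.flat_quotient_familyIdeal ℓ R _,
    fun c hc => ⟨_, h.fiberIdeal_familyIdeal hδ hc⟩, hfiber⟩
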